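/- Throughout, $\mathfrak H$ is the upper half plane and $z^s=e^{s\log z}$ with $\operatorname{Im}\log z\in\,]-\pi,\pi]$. If $g\neq 0$ is holomorphic on $\mathfrak H$ and $g(z+h)=u\,g(z)$ with $h>0$ real and $|u|=1$, then $g$ has a unique expansion $g(z)=\sum_{\lambda\in\Lambda}a(\lambda)e^{2\pi i\lambda z}$, where $\Lambda=\{\lambda\in\mathbf R : e^{2\pi i\lambda h}=u\}$; $g$ has finite order at $\infty$ if $a(\lambda)\ne0$ for only finitely many $\lambda<0$. Let $\Gamma$ be a finite index subgroup of $\mathbf{SL}_2(\mathbf Z)$, let $k<0$ be real, and let $f\ne 0$ be a holomorphic function on $\mathfrak H$ which is a modular function of weight $k$ for $\Gamma$: (a) for each $\gamma=\begin{pmatrix}a&b\\c&d\end{pmatrix}\in\Gamma$ there is a holomorphic function $j(\gamma,\cdot)$ on $\mathfrak H$ with $|j(\gamma,z)|=|cz+d|^k$ and $f(\gamma z)=j(\gamma,z)f(z)$; (b) for each $\begin{pmatrix}a&b\\c&d\end{pmatrix}\in\mathbf{SL}_2(\mathbf Z)$ the function $z\mapsto(cz+d)^{-k}f\left(\frac{az+b}{cz+d}\right)$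 has finite order at $\infty$. Let $h$ be the smallest positive integer with $\begin{pmatrix}1&h\\0&1\end{pmatrix}\in\Gamma$, let $u$ be the constant (of absolute value $1$) with $f(z+h)=u f(z)$, and let $f(z)=\sum_{\lambda\in\Lambda}a(\lambda)e^{2\pi i\lambda z}$, $\Lambda=\{\lambda\in\mathbf R: e^{2\pi i\lambda h}=u\}$, be the expansion of $f$ at $\infty$. For each $x\in\mathbf Q$ choose $\gamma=\begin{pmatrix}a&b\\c&d\end{pmatrix}\in\mathbf{SL}_2(\mathbf Z)$ with $c>0$ and $x=a/c$; put $f_\gamma(z)=\left(\frac{cz+d}{i}\right)^{-k}f(\gamma z)$, let $h_\gamma$ be the smallest positive integer with $f_\gamma(z+h_\gamma)=u_\gamma f_\gamma(z)$ for some $u_\gamma\in\mathbf C$, let $f_\gamma(z)=\sum_{\mu\in\Lambda_x}a_\gamma(\mu)e^{2\pi i\mu z}$ with $\Lambda_x=\{\mu\in\mathbf R: e^{2\pi i\mu h_\gamma}=u_\gamma\}$ be its expansion at $\infty$, and put $\beta_x(\lambda,\mu)=a_\gamma(\mu)\,e^{-2\pi i(\lambda a+\mu d)/c}$. Let $L_\nu(t)=\sum_{n\ge0}\frac{t^n}{n!\,\Gamma(n+\nu+1)}$.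 Theorem 5. For every such choice of matrices and for every $\lambda\in\Lambda$, $$a(\lambda)=(2\pi)^{2-k}h^{-1}\sum_{x\in\mathbf Q\cap[0,h[}c^{k-2}\sum_{\mu\in\Lambda_x,\ \mu<0}\beta_x(\lambda,\mu)\,|\mu|^{1-k}\,L_{1-k}\!\left(4\pi^2\lambda|\mu|c^{-2}\right),$$ where $c\ge1$ denotes the denominator of $x$; the series over $x$ converges absolutely. -/

import Mathlib

open scoped UpperHalfPlane MatrixGroups Manifold Real

/-! ## Expansions at infinity -/

namespace ModularExpansion

section

open Complex MeasureTheory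

/-- For a non-zero `g` on the upper half plane with `g (z + h) = u * g z`, this is the set `Λ` of
all real `lam` with `exp (2 π i lam h) = u`. -/
def exponents (g : ℍ → ℂ) (h : ℝ) : Set ℝ :=
  {lam | ∀ z : ℍ, g (h +ᵥ z) = exp (2 * π * I * lam * h) * g z}

/-- `g z = ∑_{lam ∈ Λ} a lam * exp (2 π i lam z)` on the upper half plane (and `a` is extended by
zero outside `Λ`). -/
def IsExpansion (g : ℍ → ℂ) (h : ℝ) (a : ℝ → ℂ) : Prop :=
  (∀ lam, lam ∉ exponents g h → a lam = 0) ∧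
    ∀ z : ℍ, HasSum (fun lam : exponents g h => a lam * exp (2 * π * I * (lam : ℝ) * z)) (g z)

/-- The coefficients of the expansion of `g` at infinity. For `h > 0` and a non-zero holomorphic
`g` with `g (z + h) = u * g z`, `|u| = 1`, the expansion exists and is unique, see
`isExpansion_coeff` and `IsExpansion.eq_coeff` below. -/
noncomputable def coeff (g : ℍ → ℂ) (h : ℝ) : ℝ → ℂ :=
  Classical.epsilon (IsExpansion g h)

/-- `g` has finite order at infinity: `g (z + h) = u * g z` for some `h > 0` and some `u` with
`|u| = 1`, and only finitely many negative exponents occur in the expansion. -/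
def HasFiniteOrder (g : ℍ → ℂ) : Prop :=
  ∃ h : ℝ, 0 < h ∧ (∃ u : ℂ, ‖u‖ = 1 ∧ ∀ z : ℍ, g (h +ᵥ z) = u * g z) ∧
    {lam : ℝ | lam < 0 ∧ coeff g h lam ≠ 0}.Finite

/-! The expansion exists and is unique. -/

theorem aux_indep {F : ℂ → ℂ} (hF : DifferentiableOn ℂ F {z | 0 < z.im}) {h : ℝ}
    (hp : ∀ z : ℂ, 0 < z.im → F (z + h) = F z) {y y' : ℝ} (hy : 0 < y) (hy' : 0 < y') :
    ∫ t in (0:ℝ)..h, F (t + y * I) = ∫ t in (0:ℝ)..h, F (t + y' * I) := by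
  have key := integral_boundary_rect_eq_zero_of_differentiableOn F (y * I) (h + y' * I) (by
    refine hF.mono fun z hz => ?_
    have h2 := hz.2
    simp only [Set.mem_preimage, mul_im, ofReal_re, I_im, mul_one, ofReal_im, I_re, mul_zero,
      add_zero, add_im, zero_add] at h2
    rcases Set.mem_uIcc.1 h2 with h3 | h3
    · exact lt_of_lt_of_le hy h3.1
    · exact lt_of_lt_of_le hy' h3.1)
  simp only [mul_re, ofReal_re, I_re, mul_zero, ofReal_im, I_im, mul_one, add_re, mul_im,
    add_zero, add_im, zero_add, sub_self, ofReal_zero] at key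
  have hside : ∫ s in y..y', F (h + s * I) = ∫ s in y..y', F (s * I) := by
    refine intervalIntegral.integral_congr fun s hs => ?_
    have hs0 : 0 < s := by
      rcases Set.mem_uIcc.1 hs with h3 | h3
      · exact lt_of_lt_of_le hy h3.1
      · exact lt_of_lt_of_le hy' h3.1
    have := hp (s * I) (by simpa using hs0)
    simpa [add_comm] using this
  rw [hside] at key
  linear_combination key

theorem aux_fourier_bound {h : ℝ} [Fact (0 < h)] (φ : C(AddCircle h, ℂ)) (n : ℤ) :
    ‖fourierCoeff φ n‖ ≤ ‖φ‖ := by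
  have := norm_integral_le_of_norm_le_const (μ := (AddCircle.haarAddCircle : Measure (AddCircle h)))
    (f := fun t => fourier (-n) t • φ t) (C := ‖φ‖) (Filter.Eventually.of_forall fun t => by
      rw [norm_smul, fourier_apply, Circle.norm_coe, one_mul]
      exact φ.norm_coe_le_norm t)
  simpa [fourierCoeff] using this

theorem aux_line {F : ℂ → ℂ} (hF : DifferentiableOn ℂ F {z | 0 < z.im}) {h : ℝ} [Fact (0 < h)]
    (hp : ∀ z : ℂ, 0 < z.im → F (z + h) = F z) {y : ℝ} (hy : 0 < y) :
    ∃ φ : C(AddCircle h, ℂ), ∀ t : ℝ, φ t = F (t + y * I) := by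
  have hper : Function.Periodic (fun t : ℝ => F (t + y * I)) h := fun t => by
    have := hp (t + y * I) (by simpa using hy)
    simp only [ofReal_add]
    rw [← this]; ring_nf
  refine ⟨⟨hper.lift, ?_⟩, fun t => hper.lift_coe t⟩
  refine continuous_coinduced_dom.mpr ?_
  change Continuous fun t : ℝ => F (t + y * I)
  refine hF.continuousOn.comp_continuous (by fun_prop) fun t => by simpa using hy

theorem aux_periodic {F : ℂ → ℂ} (hF : DifferentiableOn ℂ F {z | 0 < z.im}) {h : ℝ} (hh : 0 < h)
    (hp : ∀ z : ℂ, 0 < z.im → F (z + h) = F z) :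
    ∃ c : ℤ → ℂ, ∀ z : ℂ, 0 < z.im →
      HasSum (fun n : ℤ => c n * exp (2 * π * I * (n / h) * z)) (F z) := by
  have : Fact (0 < h) := ⟨hh⟩
  have hh0 : (h : ℂ) ≠ 0 := ofReal_ne_zero.2 hh.ne'
  choose φ hφ using fun y : {y : ℝ // 0 < y} => aux_line hF hp y.2
  set G : ℤ → ℂ → ℂ := fun n z => F z * exp (-(2 * π * I * (n / h) * z)) with hG
  have hGd : ∀ n, DifferentiableOn ℂ (G n) {z | 0 < z.im} := fun n =>
    hF.mul (by fun_prop)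
  have hGp : ∀ n (z : ℂ), 0 < z.im → G n (z + h) = G n z := fun n z hz => by
    simp only [hG]
    rw [hp z hz]
    congr 1
    rw [exp_eq_exp_iff_exists_int]
    refine ⟨-n, ?_⟩
    push_cast
    field_simp
    ring
  have hcoef : ∀ (y : {y : ℝ // 0 < y}) n,
      fourierCoeff (φ y) n = ((1 / h : ℝ) • ∫ t in (0:ℝ)..h, G n (t + y.1 * I)) *
        exp (2 * π * I * (n / h) * (y.1 * I)) := by
    intro y n
    rw [fourierCoeff_eq_intervalIntegral _ n 0, zero_add, smul_mul_assoc,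
      ← intervalIntegral.integral_mul_const]
    congr 1
    refine intervalIntegral.integral_congr fun t _ => ?_
    simp only [hG, hφ, smul_eq_mul]
    rw [fourier_coe_apply, mul_comm (exp _) (F _), mul_assoc (F _), ← exp_add]
    congr 2
    push_cast
    field_simp
    ring
  set c : ℤ → ℂ := fun n => (1 / h : ℝ) • ∫ t in (0:ℝ)..h, G n (t + (1:ℝ) * I) with hc
  have hcoef' : ∀ (y : {y : ℝ // 0 < y}) n, fourierCoeff (φ y) n =
      c n * exp (2 * π * I * (n / h) * (y.1 * I)) := fun y n => by
    rw [hcoef, aux_indep (hGd n) (hGp n) y.2 one_pos]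
  have hnorm : ∀ (y : {y : ℝ // 0 < y}) (n : ℤ), ‖fourierCoeff (φ y) n‖ =
      ‖c n‖ * Real.exp (-(2 * π * (n / h) * y.1)) := fun y n => by
    rw [hcoef', norm_mul, norm_exp]
    congr 2
    have : 2 * π * I * (n / h) * (y.1 * I) = ((-(2 * π * (n / h) * y.1) : ℝ) : ℂ) := by
      push_cast
      linear_combination (2 * π * (n / h) * y.1 : ℂ) * I_mul_I
    rw [this, ofReal_re]
  have hsum : ∀ y : {y : ℝ // 0 < y}, Summable (fourierCoeff (φ y)) := by
    intro y
    have hy := y.2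
    set y1 : {y : ℝ // 0 < y} := ⟨y.1 / 2, by linarith⟩
    set y2 : {y : ℝ // 0 < y} := ⟨y.1 + y.1 / 2, by linarith⟩
    set q : ℝ := 2 * π / h * (y.1 / 2) with hq
    have hq0 : 0 < q := by positivity
    have hgeo : Summable fun n : ℕ => Real.exp (-q) ^ n :=
      summable_geometric_of_lt_one (Real.exp_pos _).le (Real.exp_zero ▸ Real.exp_lt_exp.2 (by linarith))
    refine Summable.of_nat_of_neg ?_ ?_
    · refine Summable.of_norm_bounded (hgeo.mul_left ‖φ y1‖) fun n => ?_
      have hb := aux_fourier_bound (φ y1) n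
      rw [hnorm] at hb
      rw [hnorm, ← Real.exp_nat_mul]
      have : Real.exp (-(2 * π * ((n:ℤ) / h) * y.1)) =
          Real.exp (-(2 * π * ((n:ℤ) / h) * y1.1)) * Real.exp (n * -q) := by
        rw [← Real.exp_add]; congr 1; simp only [y1, hq]; push_cast; field_simp; ring
      rw [this, ← mul_assoc]
      gcongr
    · refine Summable.of_norm_bounded (hgeo.mul_left ‖φ y2‖) fun n => ?_
      have hb := aux_fourier_bound (φ y2) (-n)
      rw [hnorm] at hb
      rw [hnorm, ← Real.exp_nat_mul]
      have : Real.exp (-(2 * π * ((-n:ℤ) / h) * y.1)) =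
          Real.exp (-(2 * π * ((-n:ℤ) / h) * y2.1)) * Real.exp (n * -q) := by
        rw [← Real.exp_add]; congr 1; simp only [y2, hq]; push_cast; field_simp; ring
      rw [this, ← mul_assoc]
      gcongr
  refine ⟨c, fun z hz => ?_⟩
  have := has_pointwise_sum_fourier_series_of_summable (hsum ⟨z.im, hz⟩) (z.re : AddCircle h)
  rw [hφ, re_add_im] at this
  convert! this using 2 with n
  rw [hcoef', fourier_coe_apply, smul_eq_mul, mul_assoc (c n), ← exp_add]
  congr 2
  conv_lhs => rw [← re_add_im z]
  field_simp
  ring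

theorem aux_unique {h : ℝ} (hh : 0 < h) {d : ℤ → ℂ}
    (hd : ∀ t : ℝ, HasSum (fun n : ℤ => d n * exp (2 * π * I * n * t / h)) 0) : d = 0 := by
  have : Fact (0 < h) := ⟨hh⟩
  have hs : Summable fun n => ‖d n‖ := by
    have := (hd 0).summable.norm
    simpa using this
  funext m
  have hI := hasSum_integral_of_summable_integral_norm
    (μ := (AddCircle.haarAddCircle : Measure (AddCircle h)))
    (F := fun (n : ℤ) t => fourier (-m) t • (d n • fourier n t)) (fun n => by
      refine Continuous.integrable_of_hasCompactSupport (by fun_prop) ?_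
      exact HasCompactSupport.of_compactSpace _) (by
      refine hs.congr fun n => ?_
      simp [fourier_apply, Circle.norm_coe])
  have h0 : ∀ t : AddCircle h, ∑' n, fourier (-m) t • (d n • fourier n t) = 0 := fun t => by
    induction t using QuotientAddGroup.induction_on with
    | H t =>
      have := ((hd t).mul_left (fourier (-m) (t : AddCircle h))).tsum_eq
      rw [mul_zero] at this
      rw [← this]
      refine tsum_congr fun n => ?_
      rw [smul_eq_mul, smul_eq_mul, fourier_coe_apply (n := n)]
  simp only [h0, integral_zero] at hI
  have hterm : ∀ n, ∫ t, fourier (-m) t • (d n • fourier n t)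
      ∂(AddCircle.haarAddCircle : Measure (AddCircle h)) = if n = m then d m else 0 := fun n => by
    have h1 := congrFun (fourierCoeff_fourier (T := h) n) m
    have h2 := fourierCoeff.const_smul (T := h) (fourier n) (d n) m
    rw [h1] at h2
    have h3 : fourierCoeff (T := h) (d n • (fourier n : AddCircle h → ℂ)) m =
      ∫ t, fourier (-m) t • (d n • fourier n t)
      ∂(AddCircle.haarAddCircle : Measure (AddCircle h)) := rfl
    rw [← h3, h2, Pi.single_apply]
    by_cases hnm : n = m
    · simp [hnm]
    · simp [hnm, Ne.symm hnm]
  simp only [hterm] at hI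
  exact (hasSum_ite_eq m (d m)).unique hI

theorem exponents_nonempty {g : ℍ → ℂ} {h : ℝ} (hh : 0 < h) {u : ℂ} (hu : ‖u‖ = 1)
    (hgu : ∀ z : ℍ, g (h +ᵥ z) = u * g z) : (exponents g h).Nonempty := by
  refine ⟨arg u / (2 * π * h), fun z => ?_⟩
  rw [hgu]
  congr 1
  have h1 := norm_mul_exp_arg_mul_I u
  rw [hu, ofReal_one, one_mul] at h1
  conv_lhs => rw [← h1]
  have hh0 : (h : ℂ) ≠ 0 := ofReal_ne_zero.2 hh.ne'
  have hpi : (π : ℂ) ≠ 0 := ofReal_ne_zero.2 Real.pi_ne_zero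
  congr 1
  push_cast
  field_simp

theorem exists_equiv {g : ℍ → ℂ} (hg0 : g ≠ 0) {h : ℝ} (hh : 0 < h) {l0 : ℝ}
    (hl : l0 ∈ exponents g h) :
    ∃ e : ℤ ≃ exponents g h, ∀ n, (e n : ℝ) = l0 + n / h := by
  have hh0 : (h : ℂ) ≠ 0 := ofReal_ne_zero.2 hh.ne'
  have hpi : (2 * π * I : ℂ) ≠ 0 := two_pi_I_ne_zero
  have hmem : ∀ n : ℤ, l0 + n / h ∈ exponents g h := fun n z => by
    rw [hl z]
    congr 1
    rw [exp_eq_exp_iff_exists_int]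
    refine ⟨-n, ?_⟩
    push_cast
    field_simp
    ring
  refine ⟨Equiv.ofBijective (fun n => ⟨l0 + n / h, hmem n⟩) ⟨fun m n hmn => ?_, fun l => ?_⟩,
    fun n => rfl⟩
  · have h1 : l0 + m / h = l0 + n / h := congrArg Subtype.val hmn
    have h2 : (m : ℝ) / h = n / h := by linarith
    rw [div_left_inj' hh.ne'] at h2
    exact_mod_cast h2
  · obtain ⟨z, hz⟩ := Function.ne_iff.1 hg0
    have h1 := (l.2 z).symm.trans (hl z)
    have h2 := mul_right_cancel₀ hz h1
    obtain ⟨n, hn⟩ := exp_eq_exp_iff_exists_int.1 h2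
    refine ⟨n, Subtype.ext ?_⟩
    have h3 : ((l : ℝ) : ℂ) * h = l0 * h + n := by
      apply mul_left_cancel₀ hpi
      linear_combination hn
    have h4 : (l : ℝ) * h = l0 * h + n := by exact_mod_cast h3
    change l0 + n / h = (l : ℝ)
    field_simp
    linarith

theorem exists_isExpansion {g : ℍ → ℂ} (hg : MDifferentiable 𝓘(ℂ) 𝓘(ℂ) g) (hg0 : g ≠ 0) {h : ℝ}
    (hh : 0 < h) (hne : (exponents g h).Nonempty) : ∃ a, IsExpansion g h a := by
  classical
  obtain ⟨l0, hl⟩ := hne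
  obtain ⟨e, he⟩ := exists_equiv hg0 hh hl
  have hd := UpperHalfPlane.mdifferentiable_iff.1 hg
  obtain ⟨c, hc⟩ := aux_periodic
    (F := fun z => (g ∘ UpperHalfPlane.ofComplex) z * exp (-(2 * π * I * l0 * z)))
    (hd.mul (by fun_prop)) hh (fun z hz => by
      have hz' : 0 < (z + h).im := by simpa using hz
      have h1 : UpperHalfPlane.ofComplex (z + h) = h +ᵥ UpperHalfPlane.ofComplex z := by
        rw [UpperHalfPlane.ofComplex_apply_of_im_pos hz',
          UpperHalfPlane.ofComplex_apply_of_im_pos hz]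
        ext
        simp [add_comm]
      simp only [Function.comp_apply]
      rw [h1, hl, mul_comm (exp _), mul_assoc, ← exp_add]
      congr 2
      ring)
  refine ⟨fun l => if hl : l ∈ exponents g h then c (e.symm ⟨l, hl⟩) else 0,
    fun l hl => dif_neg hl, fun z => ?_⟩
  have h1 := (hc z z.im_pos).mul_right (exp (2 * π * I * l0 * z))
  have h2 : (g ∘ UpperHalfPlane.ofComplex) z * exp (-(2 * π * I * l0 * z)) *
      exp (2 * π * I * l0 * z) = g z := by
    rw [mul_assoc, ← exp_add, neg_add_cancel, exp_zero, mul_one, Function.comp_apply,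
      UpperHalfPlane.ofComplex_apply]
  rw [h2] at h1
  rw [← e.hasSum_iff]
  convert! h1 using 2 with n
  simp only [Function.comp_apply, Subtype.coe_prop, dif_pos, Subtype.coe_eta,
    Equiv.symm_apply_apply]
  rw [mul_assoc (c n), ← exp_add, he]
  congr 2
  push_cast
  ring

theorem IsExpansion.unique {g : ℍ → ℂ} (hg0 : g ≠ 0) {h : ℝ} (hh : 0 < h)
    (hne : (exponents g h).Nonempty) {a b : ℝ → ℂ} (ha : IsExpansion g h a)
    (hb : IsExpansion g h b) : a = b := by
  obtain ⟨l0, hl⟩ := hne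
  obtain ⟨e, he⟩ := exists_equiv hg0 hh hl
  have hh0 : (h : ℂ) ≠ 0 := ofReal_ne_zero.2 hh.ne'
  have h0 := aux_unique hh (d := fun n => (a (e n) - b (e n)) * exp (2 * π * I * (n / h) * I))
    (fun t => by
      set z : ℍ := ⟨t + I, by simp⟩ with hz
      have h1 := ((ha.2 z).sub (hb.2 z)).mul_right (exp (-(2 * π * I * l0 * z)))
      rw [sub_self, zero_mul, ← e.hasSum_iff] at h1
      convert! h1 using 2 with n
      simp only [Function.comp_apply]
      rw [← sub_mul, mul_assoc (a (e n) - b (e n)), mul_assoc (a (e n) - b (e n)), ← exp_add,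
        ← exp_add, he]
      congr 2
      have : (z : ℂ) = t + I := rfl
      rw [this]
      push_cast
      field_simp
      ring)
  funext l
  by_cases hl : l ∈ exponents g h
  · have h1 := congrFun h0 (e.symm ⟨l, hl⟩)
    simp only [Equiv.apply_symm_apply, Pi.zero_apply, mul_eq_zero, exp_ne_zero, or_false] at h1
    exact sub_eq_zero.1 h1
  · rw [ha.1 l hl, hb.1 l hl]

/-- Existence of the expansion. -/
theorem isExpansion_coeff {g : ℍ → ℂ} (hg : MDifferentiable 𝓘(ℂ) 𝓘(ℂ) g) (hg0 : g ≠ 0) {h : ℝ}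
    (hh : 0 < h) {u : ℂ} (hu : ‖u‖ = 1) (hgu : ∀ z : ℍ, g (h +ᵥ z) = u * g z) :
    IsExpansion g h (coeff g h) :=
  Classical.epsilon_spec (exists_isExpansion hg hg0 hh (exponents_nonempty hh hu hgu))

/-- Uniqueness of the expansion. -/
theorem IsExpansion.eq_coeff {g : ℍ → ℂ} (hg0 : g ≠ 0) {h : ℝ} (hh : 0 < h) {u : ℂ}
    (hu : ‖u‖ = 1) (hgu : ∀ z : ℍ, g (h +ᵥ z) = u * g z) {a : ℝ → ℂ} (ha : IsExpansion g h a) :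
    a = coeff g h :=
  ha.unique hg0 hh (exponents_nonempty hh hu hgu) (Classical.epsilon_spec ⟨a, ha⟩)

/-! ## Modular functions of real weight -/

/-- `f` is a modular function of weight `k` for `Γ` which is holomorphic on the upper half
plane. Complex powers use the argument in `(-π, π]`. -/
structure IsHolomorphicModularFunction (Γ : Subgroup SL(2, ℤ)) (k : ℝ) (f : ℍ → ℂ) : Prop where
  holo : MDifferentiable 𝓘(ℂ) 𝓘(ℂ) f
  automorphy : ∀ γ ∈ Γ, ∃ j : ℍ → ℂ, MDifferentiable 𝓘(ℂ) 𝓘(ℂ) j ∧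
    (∀ z : ℍ, ‖j z‖ = ‖((γ 1 0 : ℤ) : ℂ) * z + ((γ 1 1 : ℤ) : ℂ)‖ ^ k) ∧
    ∀ z : ℍ, f (γ • z) = j z * f z
  finiteOrder : ∀ γ : SL(2, ℤ), HasFiniteOrder fun z : ℍ =>
    (((γ 1 0 : ℤ) : ℂ) * z + ((γ 1 1 : ℤ) : ℂ)) ^ (-(k : ℂ)) * f (γ • z)

/-- `f_γ z = ((c z + d) / i) ^ (-k) * f (γ z)`. -/
noncomputable def transform (k : ℝ) (f : ℍ → ℂ) (γ : SL(2, ℤ)) : ℍ → ℂ := fun z =>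
  ((((γ 1 0 : ℤ) : ℂ) * z + ((γ 1 1 : ℤ) : ℂ)) / I) ^ (-(k : ℂ)) * f (γ • z)

/-- The smallest positive integer `n` such that `g (z + n) = u * g z` for some complex `u`. -/
noncomputable def quasiPeriod (g : ℍ → ℂ) : ℕ :=
  sInf {n : ℕ | 0 < n ∧ ∃ u : ℂ, ∀ z : ℍ, g ((n : ℝ) +ᵥ z) = u * g z}

/-- The set `Λ_γ` of exponents of the expansion of `f_γ` at infinity. -/
noncomputable def cuspExponents (k : ℝ) (f : ℍ → ℂ) (γ : SL(2, ℤ)) : Set ℝ :=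
  exponents (transform k f γ) (quasiPeriod (transform k f γ))

/-- The coefficients `a_γ(mu)` of the expansion of `f_γ` at infinity. -/
noncomputable def cuspCoeff (k : ℝ) (f : ℍ → ℂ) (γ : SL(2, ℤ)) : ℝ → ℂ :=
  coeff (transform k f γ) (quasiPeriod (transform k f γ))

/-- `β_x(lam, mu) = a_γ(mu) * exp (-2 π i (lam a + mu d) / c)`, where `γ = (a b; c d)` satisfies
`x = a / c` and `c > 0`. -/
noncomputable def beta (k : ℝ) (f : ℍ → ℂ) (γ : SL(2, ℤ)) (lam mu : ℝ) : ℂ :=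
  cuspCoeff k f γ mu *
    exp (-(2 * π * I * ((lam * (γ 0 0 : ℤ) + mu * (γ 1 1 : ℤ)) / (γ 1 0 : ℤ))))

/-- `L_ν(t) = ∑ t ^ n / (n! Γ(n + ν + 1))` (at the poles of `Γ` the value of `1 / Γ` is `0`). -/
noncomputable def besselL (ν t : ℂ) : ℂ :=
  ∑' n : ℕ, t ^ n / (n.factorial * Gamma (n + ν + 1))

end

end ModularExpansion

namespace ModularExpansion

open Complex MeasureTheory

/-! Write `φ z = f z * exp (-2πi lam z)`; it is invariant under translation by `h`. Average it in
weight two, not in weight `k`: sum `φ ∣[2] g` over representatives `g` of `⟨±T ^ h⟩ \ SL(2, ℤ)`.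
Since `f (g z)` is `O(|cz + d| ^ k)` uniformly in `g` (`exists_norm_smul_le`), the terms are `O(|cz
+ d| ^ (k - 2))`, and the sum converges absolutely because `2 - k > 2`. The group `Γ` enters only
through this bound and through the expansions at the cusps, so no multiplier system appears in the
sum.

The sum `F` satisfies `F (-1/z) = z ^ 2 * F z`, so `F dz` is invariant under `z ↦ -1/z`. This map
fixes `i` and exchanges `ρ` with `ρ + 1`, where `ρ` is the primitive third root of unity in the
upper half plane; hence the integral of `F` from `ρ` to `ρ + 1` vanishes
(`integral_eq_zero_of_weight_two`, `hasSum_integral_slash`).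

Integrating termwise gives the formula. The representatives `T ^ j`, `0 ≤ j < h`, give the integral
of `φ` over a full period, which is `h * a(lam)`. Every other coset is represented by exactly one `γ
x * T ^ m` with `0 ≤ x < h` and `m` an integer (`bijective_cosetRep`); summing over `m` unfolds the
unit segments to a whole horizontal line (`hasSum_integral_cusps`). On that line `f_γ` is replaced
by its expansion, and each exponent `mu` leaves an inverse Laplace transform of `s ^ (-(2 - k)) *
exp (B / s)`, evaluated at `-mu`. It vanishes for `mu ≥ 0` and is a Bessel value for `mu < 0`
(`integral_cpow_mul_exp_mul_exp_div`, `integral_slash_twist`), so only the principal parts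
contribute. -/

/-! ## Forms of weight two on a hyperbolic disc -/

/-- A hyperbolic disc around `i`, invariant under `z ↦ -1 / z` and containing the third root of
unity in the upper half plane. -/
def hypDisc : Set ℂ := Metric.ball (5 / 4 * I) (3 / 4)

/-- This form makes the symmetry visible: `z ↦ -1/z` divides both sides by `normSq z`. -/
theorem mem_hypDisc_iff {z : ℂ} : z ∈ hypDisc ↔ normSq z + 1 < 5 / 2 * z.im := by
  rw [hypDisc, Metric.mem_ball, Complex.dist_eq, ← sq_lt_sq₀ (norm_nonneg _) (by norm_num),
    ← normSq_eq_norm_sq, normSq_apply, normSq_apply]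
  have h1 : (z - 5 / 4 * I).re = z.re := by simp
  have h2 : (z - 5 / 4 * I).im = z.im - 5 / 4 := by
    have : ((5 / 4 : ℂ) * I).im = 5 / 4 := by
      have : (5 / 4 : ℂ) = ((5 / 4 : ℝ) : ℂ) := by norm_num
      rw [this, im_ofReal_mul, I_im, mul_one]
    rw [sub_im, this]
  rw [h1, h2]
  constructor <;> intro h <;> nlinarith

theorem isOpen_hypDisc : IsOpen hypDisc := Metric.isOpen_ball

theorem im_pos_of_mem_hypDisc {z : ℂ} (hz : z ∈ hypDisc) : 0 < z.im := by
  have := mem_hypDisc_iff.1 hz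
  have := normSq_nonneg z
  linarith

theorem ne_zero_of_mem_hypDisc {z : ℂ} (hz : z ∈ hypDisc) : z ≠ 0 := by
  rintro rfl
  simpa using im_pos_of_mem_hypDisc hz

theorem neg_inv_mem_hypDisc {z : ℂ} (hz : z ∈ hypDisc) : -z⁻¹ ∈ hypDisc := by
  have h0 : 0 < normSq z := normSq_pos.2 (ne_zero_of_mem_hypDisc hz)
  rw [mem_hypDisc_iff] at hz ⊢
  rw [normSq_neg, normSq_inv, neg_im, inv_im, neg_div, neg_neg]
  field_simp
  linarith

theorem add_sqrt_mul_I_mem_hypDisc {t : ℝ} (ht : t ∈ Set.Icc (-(1 / 2) : ℝ) (1 / 2)) :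
    (t : ℂ) + (√3 / 2 : ℝ) * I ∈ hypDisc := by
  rw [mem_hypDisc_iff, normSq_add_mul_I]
  have him : ((t : ℂ) + (√3 / 2 : ℝ) * I).im = √3 / 2 := by simp
  have h3 : √3 ^ 2 = 3 := Real.sq_sqrt (by norm_num)
  -- The left side is at most `1/4 + 3/4 + 1 = 2`, while `5/4 * 1.7 = 2.125`.
  have : 1.7 < √3 := Real.lt_sqrt_of_sq_lt (by norm_num)
  rw [him]
  nlinarith [ht.1, ht.2]

/-- A primitive `G` on the disc makes `G (-1/z) - G z` constant, since its derivative is `F (-1/z) /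
z ^ 2 - F z = 0`. The constant is `0` at the fixed point `i`. The endpoints of the segment are `ρ`
and `-1/ρ = ρ + 1`, so the integral is this constant at `ρ`. -/
theorem integral_eq_zero_of_weight_two {F : ℂ → ℂ} (hF : DifferentiableOn ℂ F hypDisc)
    (hS : ∀ z ∈ hypDisc, F (-z⁻¹) = z ^ 2 * F z) :
    ∫ t in (-(1 / 2) : ℝ)..(1 / 2), F (t + (√3 / 2 : ℝ) * I) = 0 := by
  obtain ⟨G, hG⟩ := DifferentiableOn.isExactOn_ball hF
  replace hG : ∀ z ∈ hypDisc, HasDerivAt G (F z) z := hG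
  have hinv : ∀ z ∈ hypDisc, G (-z⁻¹) - G z = G (-I⁻¹) - G I := by
    intro z hz
    have hI : I ∈ hypDisc := by rw [mem_hypDisc_iff]; simp; norm_num
    have hd : ∀ w ∈ hypDisc, HasDerivAt (fun w => G (-w⁻¹) - G w) 0 w := fun w hw => by
      have hw0 := ne_zero_of_mem_hypDisc hw
      have h1 := (hG _ (neg_inv_mem_hypDisc hw)).comp w (hasDerivAt_inv hw0).neg
      have h2 := h1.sub (hG w hw)
      convert! h2 using 1
      rw [hS w hw]
      field_simp
      ring
    exact (convex_ball (5 / 4 * I) (3 / 4)).is_const_of_fderivWithin_eq_zero (𝕜 := ℂ)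
      (f := fun w => G (-w⁻¹) - G w)
      (fun w hw => (hd w hw).differentiableAt.differentiableWithinAt)
      (fun w hw => by
        rw [fderivWithin_of_isOpen Metric.isOpen_ball hw]
        have := (hd w hw).hasFDerivAt.fderiv
        rw [this]; ext; simp) hz hI
  have hder : ∀ t ∈ Set.uIcc (-(1 / 2) : ℝ) (1 / 2),
      HasDerivAt (fun t : ℝ => G (t + (√3 / 2 : ℝ) * I)) (F (t + (√3 / 2 : ℝ) * I)) t := by
    intro t ht
    rw [Set.uIcc_of_le (by norm_num)] at ht
    have h1 := hG _ (add_sqrt_mul_I_mem_hypDisc ht)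
    have h2 : HasDerivAt (fun t : ℝ => (t : ℂ) + (√3 / 2 : ℝ) * I) 1 t :=
      (ofRealCLM.hasDerivAt (x := t)).add_const _
    have h3 := h1.scomp t h2
    rwa [one_smul] at h3
  have hcont : ContinuousOn (fun t : ℝ => F (t + (√3 / 2 : ℝ) * I))
      (Set.uIcc (-(1 / 2) : ℝ) (1 / 2)) := by
    refine hF.continuousOn.comp (by fun_prop) fun t ht => ?_
    rw [Set.uIcc_of_le (by norm_num)] at ht
    exact add_sqrt_mul_I_mem_hypDisc ht
  rw [intervalIntegral.integral_eq_sub_of_hasDerivAt hder hcont.intervalIntegrable]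
  have h3 : ((√3 : ℝ) : ℂ) ^ 2 = 3 := by
    rw [← ofReal_pow, Real.sq_sqrt (by norm_num)]; norm_num
  have hmem := add_sqrt_mul_I_mem_hypDisc (t := -(1 / 2)) (by norm_num)
  have h0 := ne_zero_of_mem_hypDisc hmem
  have hrho : -(((-(1 / 2) : ℝ) : ℂ) + (√3 / 2 : ℝ) * I)⁻¹ = ((1 / 2 : ℝ) : ℂ) + (√3 / 2 : ℝ) * I := by
    rw [neg_eq_iff_eq_neg]
    refine inv_eq_of_mul_eq_one_left ?_
    push_cast
    linear_combination (-1 / 4 : ℂ) * I ^ 2 * h3 - (3 / 4 : ℂ) * I_sq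
  have := hinv _ hmem
  rw [hrho] at this
  rw [this]
  simp

end ModularExpansion

namespace ModularExpansion

open Complex MeasureTheory

/-! ## An inverse Laplace transform -/

theorem add_mul_I_ne_zero {Y : ℝ} (hY : 0 < Y) (t : ℝ) : (Y : ℂ) + t * I ≠ 0 := fun h => by
  have := congrArg re h
  simp at this
  exact hY.ne' this

theorem le_norm_add_mul_I {Y : ℝ} (t : ℝ) : Y ≤ ‖(Y : ℂ) + t * I‖ := by
  have := re_le_norm ((Y : ℂ) + t * I)
  simpa using this

theorem add_mul_I_mem_slitPlane {Y : ℝ} (hY : 0 < Y) (t : ℝ) : (Y : ℂ) + t * I ∈ slitPlane :=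
  Or.inl (by simpa using hY)

theorem ofReal_mul_cpow {a : ℝ} (ha : 0 < a) {z : ℂ} (hz : z ≠ 0) (s : ℂ) :
    ((a : ℂ) * z) ^ s = (a : ℂ) ^ s * z ^ s := by
  have ha' : (a : ℂ) ≠ 0 := ofReal_ne_zero.2 ha.ne'
  rw [cpow_def_of_ne_zero (mul_ne_zero ha' hz), log_ofReal_mul ha hz, ofReal_log ha.le, add_mul,
    Complex.exp_add, ← cpow_def_of_ne_zero ha', ← cpow_def_of_ne_zero hz]

theorem continuous_cpow_add_mul_I {Y : ℝ} (hY : 0 < Y) (s : ℂ) :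
    Continuous fun t : ℝ => ((Y : ℂ) + t * I) ^ s := by
  refine continuous_iff_continuousAt.2 fun t => ?_
  exact ContinuousAt.cpow (by fun_prop) continuousAt_const (add_mul_I_mem_slitPlane hY t)

theorem norm_cpow_add_mul_I {Y : ℝ} (hY : 0 < Y) (s t : ℝ) :
    ‖((Y : ℂ) + t * I) ^ (s : ℂ)‖ = ‖(Y : ℂ) + t * I‖ ^ s := by
  rw [norm_cpow_of_ne_zero (add_mul_I_ne_zero hY t)]
  simp

theorem integrable_norm_rpow_add_mul_I {ν Y : ℝ} (hν : 1 < ν) (hY : 0 < Y) :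
    Integrable fun t : ℝ => ‖(Y : ℂ) + t * I‖ ^ (-ν) := by
  have h1 : Integrable fun t : ℝ => ((1 : ℝ) + ‖t‖ ^ 2) ^ (-ν / 2) :=
    integrable_rpow_neg_one_add_norm_sq (by simpa using hν)
  -- The comparison is `Y ^ 2 + t ^ 2 ≥ m * (1 + t ^ 2)`.
  set m := min 1 (Y ^ 2) with hm
  have hm0 : 0 < m := lt_min one_pos (by positivity)
  refine Integrable.mono' (h1.const_mul (m ^ (-ν / 2))) ?_ ?_
  · refine Continuous.aestronglyMeasurable ?_
    refine Continuous.rpow_const (by fun_prop) fun t => Or.inl ?_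
    exact norm_ne_zero_iff.2 (add_mul_I_ne_zero hY t)
  · refine Filter.Eventually.of_forall fun t => ?_
    rw [Real.norm_of_nonneg (by positivity), ← Real.mul_rpow hm0.le (by positivity)]
    have h2 : ‖(Y : ℂ) + t * I‖ ^ (-ν) = (‖(Y : ℂ) + t * I‖ ^ 2) ^ (-ν / 2) := by
      rw [← Real.rpow_natCast, ← Real.rpow_mul (norm_nonneg _)]
      congr 1
      push_cast
      ring
    rw [h2, ← normSq_eq_norm_sq, normSq_add_mul_I]
    refine Real.rpow_le_rpow_of_nonpos (by positivity) ?_ (by linarith)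
    rw [Real.norm_eq_abs, sq_abs]
    have := min_le_left 1 (Y ^ 2)
    have := min_le_right 1 (Y ^ 2)
    nlinarith [sq_nonneg t]

theorem integrable_cpow_add_mul_I {ν Y : ℝ} (hν : 1 < ν) (hY : 0 < Y) :
    Integrable fun t : ℝ => ((Y : ℂ) + t * I) ^ (-(ν : ℂ)) := by
  refine Integrable.mono' (integrable_norm_rpow_add_mul_I hν hY)
    (continuous_cpow_add_mul_I hY _).aestronglyMeasurable (Filter.Eventually.of_forall fun t => ?_)
  have := norm_cpow_add_mul_I hY (-ν) t
  rw [ofReal_neg] at this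
  exact this.le

theorem integrableOn_rpow_mul_exp_neg_mul {ν b : ℝ} (hν : 0 < ν) (hb : 0 < b) :
    IntegrableOn (fun t : ℝ => t ^ (ν - 1) * Real.exp (-b * t)) (Set.Ioi 0) := by
  simpa using integrableOn_rpow_mul_exp_neg_mul_rpow (p := 1) (s := ν - 1) (b := b)
    (by linarith) one_pos hb

theorem differentiableOn_integral_rpow_mul_exp {ν : ℝ} (hν : 0 < ν) :
    DifferentiableOn ℂ (fun r : ℂ => ∫ t in Set.Ioi (0 : ℝ), ((t ^ (ν - 1) : ℝ) : ℂ) * cexp (-r * t))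
      {r | 0 < r.re} := by
  intro r hr
  have hr' : 0 < r.re := hr
  have hmeas : ∀ r : ℂ, AEStronglyMeasurable (fun t : ℝ => ((t ^ (ν - 1) : ℝ) : ℂ) * cexp (-r * t))
      (volume.restrict (Set.Ioi (0 : ℝ))) := fun r => by
    refine ContinuousOn.aestronglyMeasurable (fun t ht => ?_) measurableSet_Ioi
    refine ContinuousAt.continuousWithinAt ?_
    refine ContinuousAt.mul (continuous_ofReal.continuousAt.comp ?_) (by fun_prop)
    exact Real.continuousAt_rpow_const _ _ (Or.inl (ne_of_gt ht))
  -- On the ball of radius `r.re / 2` real parts stay above `r.re / 2`; the factor `t` from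
  -- differentiating raises `ν` to `ν + 1` in the bound.
  have key := hasDerivAt_integral_of_dominated_loc_of_deriv_le
    (μ := volume.restrict (Set.Ioi (0 : ℝ))) (s := Metric.ball r (r.re / 2)) (x₀ := r)
    (bound := fun t : ℝ => t ^ ((ν + 1) - 1) * Real.exp (-(r.re / 2) * t))
    (F := fun r t => ((t ^ (ν - 1) : ℝ) : ℂ) * cexp (-r * t))
    (F' := fun r t => ((t ^ (ν - 1) : ℝ) : ℂ) * (cexp (-r * t) * (-t)))
    (Metric.ball_mem_nhds r (by positivity))
    (Filter.Eventually.of_forall fun r => hmeas r)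
    (by
      refine Integrable.mono' (integrableOn_rpow_mul_exp_neg_mul hν hr') (hmeas r) ?_
      refine (ae_restrict_iff' measurableSet_Ioi).2 (Filter.Eventually.of_forall fun t ht => ?_)
      rw [norm_mul, norm_real, norm_exp, Real.norm_of_nonneg (Real.rpow_nonneg (le_of_lt ht) _)]
      simp)
    (by
      have := (hmeas r).mul (g := fun t : ℝ => -(t : ℂ)) (by fun_prop)
      refine this.congr (Filter.Eventually.of_forall fun t => ?_)
      exact mul_assoc _ _ _)
    (by
      refine (ae_restrict_iff' measurableSet_Ioi).2 (Filter.Eventually.of_forall fun t ht x hx => ?_)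
      have ht' : 0 < t := ht
      rw [norm_mul, norm_real, norm_mul, norm_exp, norm_neg, norm_real,
        Real.norm_of_nonneg (Real.rpow_nonneg ht'.le _), Real.norm_of_nonneg ht'.le,
        show ν + 1 - 1 = (ν - 1) + 1 by ring, Real.rpow_add_one ht'.ne', mul_comm (Real.exp _),
        mul_assoc]
      have h1 : (-x * t).re ≤ -(r.re / 2) * t := by
        have h2 : |(x - r).re| ≤ ‖x - r‖ := abs_re_le_norm _
        rw [Metric.mem_ball, Complex.dist_eq] at hx
        rw [sub_re] at h2
        have := (abs_le.1 h2).1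
        simp only [mul_re, neg_re, ofReal_re, ofReal_im, mul_zero, sub_zero]
        nlinarith
      gcongr)
    (integrableOn_rpow_mul_exp_neg_mul (by linarith) (by positivity))
    (Filter.Eventually.of_forall fun t x _ => by
      have h1 : HasDerivAt (fun x : ℂ => -x * t) (-t) x := by
        simpa using ((hasDerivAt_id x).neg.mul_const (t : ℂ))
      exact h1.cexp.const_mul _)
  exact key.2.differentiableAt.differentiableWithinAt

/-- For real `r` this is the Gamma integral. Both sides are holomorphic for `0 < r.re`, and positive
reals accumulate at `1`, so the identity theorem applies. -/
theorem integral_rpow_mul_cexp {ν : ℝ} (hν : 0 < ν) {r : ℂ} (hr : 0 < r.re) :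
    ∫ t in Set.Ioi (0 : ℝ), ((t ^ (ν - 1) : ℝ) : ℂ) * cexp (-r * t) =
      r ^ (-(ν : ℂ)) * Real.Gamma ν := by
  have hopen : IsOpen {r : ℂ | 0 < r.re} := isOpen_lt continuous_const continuous_re
  have hd : DifferentiableOn ℂ (fun r : ℂ => r ^ (-(ν : ℂ)) * Real.Gamma ν) {r | 0 < r.re} :=
    fun r hr => ((differentiableAt_id.cpow_const (Or.inl hr)).mul_const _).differentiableWithinAt
  refine ((differentiableOn_integral_rpow_mul_exp hν).analyticOnNhd
    hopen).eqOn_of_preconnected_of_frequently_eq (hd.analyticOnNhd hopen)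
    (convex_halfSpace_re_gt 0).isPreconnected (z₀ := 1) (by simp) ?_ hr
  have hreal : ∀ x : ℝ, 0 < x → ∫ t in Set.Ioi (0 : ℝ), ((t ^ (ν - 1) : ℝ) : ℂ) * cexp (-x * t) =
      (x : ℂ) ^ (-(ν : ℂ)) * Real.Gamma ν := fun x hx => by
    have := Real.integral_rpow_mul_exp_neg_mul_Ioi hν hx
    rw [one_div, Real.inv_rpow hx.le, ← Real.rpow_neg hx.le] at this
    rw [← ofReal_neg ν, ← ofReal_cpow hx.le, ← ofReal_mul, ← this, ← integral_complex_ofReal]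
    congr 1
    funext t
    push_cast
    ring_nf
  have ht : Filter.Tendsto (fun x : ℝ => (x : ℂ)) (nhdsWithin 1 {1}ᶜ) (nhdsWithin 1 {1}ᶜ) := by
    refine tendsto_nhdsWithin_iff.2 ⟨?_, ?_⟩
    · exact (continuous_ofReal.tendsto' 1 1 (by simp)).mono_left nhdsWithin_le_nhds
    · filter_upwards [self_mem_nhdsWithin] with x hx
      simpa using hx
  refine ht.frequently (Filter.Eventually.frequently ?_)
  filter_upwards [mem_nhdsWithin_of_mem_nhds (lt_mem_nhds one_pos)] with x hx
  exact hreal x hx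

/-- The inverse Laplace transform of `s ^ (-ν)`. -/
theorem integral_cpow_mul_exp {ν Y : ℝ} (hν : 1 < ν) (hY : 0 < Y) (x : ℝ) :
    ∫ t : ℝ, ((Y : ℂ) + t * I) ^ (-(ν : ℂ)) * cexp (2 * π * x * (Y + t * I)) =
      (((2 * π) ^ ν * max x 0 ^ (ν - 1) / Real.Gamma ν : ℝ) : ℂ) := by
  -- Up to a constant, `(Y + i t) ^ (-ν)` is the Fourier transform of `g`, so the claim is Fourier
  -- inversion at `x`. The condition `1 < ν` makes `g` continuous at `0` and its transform
  -- integrable.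
  set g : ℝ → ℂ := fun v => ((max v 0 ^ (ν - 1) * Real.exp (-(2 * π * Y) * v) : ℝ) : ℂ) with hg
  have hgc : Continuous g := by
    refine continuous_ofReal.comp (Continuous.mul ?_ (by fun_prop))
    exact Continuous.rpow_const (by fun_prop) fun t => Or.inr (by linarith)
  have hν0 : ν - 1 ≠ 0 := by linarith
  have hg0 : ∀ v, v ∉ Set.Ioi (0 : ℝ) → g v = 0 := fun v hv => by
    have : max v 0 = 0 := max_eq_right (not_lt.1 hv)
    simp only [hg, this, Real.zero_rpow hν0, zero_mul, ofReal_zero]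
  have hgi : Integrable g := by
    have h1 := integrableOn_rpow_mul_exp_neg_mul_rpow (p := 1) (s := ν - 1) (b := 2 * π * Y)
      (by linarith) one_pos (by positivity)
    refine (integrableOn_iff_integrable_of_support_subset (s := Set.Ioi (0 : ℝ))
      fun v hv => by_contra fun h => hv (hg0 v h)).1 ?_
    refine (Integrable.ofReal (𝕜 := ℂ) h1).congr ?_
    refine (ae_restrict_iff' measurableSet_Ioi).2 (Filter.Eventually.of_forall fun v hv => ?_)
    simp only [hg, Real.rpow_one, max_eq_left (le_of_lt (Set.mem_Ioi.1 hv))]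
    rfl
  have hF : ∀ w : ℝ, FourierTransform.fourier g w =
      Real.Gamma ν * ((2 * π : ℝ) : ℂ) ^ (-(ν : ℂ)) * ((Y : ℂ) + w * I) ^ (-(ν : ℂ)) := by
    intro w
    rw [Real.fourier_real_eq_integral_exp_smul]
    have h1 : ∀ v : ℝ, v ∉ Set.Ioi (0 : ℝ) → cexp (↑(-2 * π * v * w) * I) • g v = 0 := fun v hv => by
      rw [hg0 v hv, smul_zero]
    rw [← setIntegral_eq_integral_of_forall_compl_eq_zero h1]
    have h2 := integral_rpow_mul_cexp (ν := ν) (r := ((2 * π : ℝ) : ℂ) * ((Y : ℂ) + w * I))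
      (by linarith) (by simp; positivity)
    rw [ofReal_mul_cpow (by positivity) (add_mul_I_ne_zero hY w)] at h2
    rw [mul_assoc, mul_comm (Real.Gamma ν : ℂ), ← h2]
    refine setIntegral_congr_fun measurableSet_Ioi fun v hv => ?_
    simp only [hg, max_eq_left (le_of_lt (Set.mem_Ioi.1 hv)), smul_eq_mul]
    push_cast
    rw [mul_left_comm, ← Complex.exp_add]
    congr 2
    ring
  have hFi : Integrable (FourierTransform.fourier g) := by
    have : FourierTransform.fourier g = fun w : ℝ => Real.Gamma ν * ((2 * π : ℝ) : ℂ) ^ (-(ν : ℂ)) *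
      ((Y : ℂ) + w * I) ^ (-(ν : ℂ)) := funext hF
    rw [this]
    exact (integrable_cpow_add_mul_I hν hY).const_mul _
  have hinv := congrFun (hgc.fourierInv_fourier_eq hgi hFi) x
  rw [Real.fourierInv_eq'] at hinv
  set C : ℂ := Real.Gamma ν * ((2 * π : ℝ) : ℂ) ^ (-(ν : ℂ)) with hC
  have hC' : C = ((Real.Gamma ν * (2 * π) ^ (-ν) : ℝ) : ℂ) := by
    rw [hC, ofReal_mul (Real.Gamma ν), ofReal_cpow (by positivity), ofReal_neg]
  have hG := Real.Gamma_pos_of_pos (by linarith : 0 < ν)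
  have hC0 : C ≠ 0 := by
    rw [hC']
    exact ofReal_ne_zero.2 (by positivity)
  have h4 : ∀ t : ℝ, ((Y : ℂ) + t * I) ^ (-(ν : ℂ)) * cexp (2 * π * x * (Y + t * I)) =
      C⁻¹ * Real.exp (2 * π * Y * x) *
        (cexp (((2 * π * inner ℝ t x : ℝ) : ℂ) * I) • FourierTransform.fourier g t) := fun t => by
    rw [hF, smul_eq_mul, real_inner_comm]
    have : cexp (2 * π * x * (Y + t * I)) = Real.exp (2 * π * Y * x) *
        cexp (((2 * π * inner ℝ x t : ℝ) : ℂ) * I) := by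
      rw [ofReal_exp, ← Complex.exp_add]
      congr 1
      simp only [RCLike.inner_apply, conj_trivial]
      push_cast
      ring
    rw [this]
    field_simp
  simp_rw [h4]
  rw [integral_const_mul, hinv, hC', hg, ← ofReal_inv, ← ofReal_mul, ← ofReal_mul]
  congr 1
  have h5 : Real.exp (2 * π * Y * x) * Real.exp (-(2 * π * Y * x)) = 1 := by
    rw [← Real.exp_add]; simp
  rw [Real.rpow_neg (by positivity)]
  have : (2 * π) ^ ν ≠ 0 := by positivity
  field_simp
  linear_combination (max x 0 ^ (ν - 1)) * h5

/-- Expand `exp (B / s)` with `s = Y + i t`: the term of index `n` replaces `ν` by `ν + n`, and the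
resulting `1 / Γ(ν + n)` are the coefficients of the Bessel series. Since `Y ≤ ‖s‖`, the terms are
dominated by those of `exp (|B| / Y)`. -/
theorem integral_cpow_mul_exp_mul_exp_div {ν Y : ℝ} (hν : 1 < ν) (hY : 0 < Y) (x B : ℝ) :
    ∫ t : ℝ, ((Y : ℂ) + t * I) ^ (-(ν : ℂ)) * cexp (2 * π * x * (Y + t * I)) *
        cexp (B / (Y + t * I)) =
      (((2 * π) ^ ν * max x 0 ^ (ν - 1) : ℝ) : ℂ) * besselL (ν - 1) (2 * π * x * B) := by
  have hcpow : ∀ (n : ℕ) (t : ℝ), ((Y : ℂ) + t * I) ^ (-(ν : ℂ)) * cexp (2 * π * x * (Y + t * I)) *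
      ((B / (Y + t * I)) ^ n / n.factorial) = (B : ℂ) ^ n / n.factorial *
        (((Y : ℂ) + t * I) ^ (-((ν + n : ℝ) : ℂ)) * cexp (2 * π * x * (Y + t * I))) := by
    intro n t
    have h0 := add_mul_I_ne_zero hY t
    have : (-((ν + n : ℝ) : ℂ)) = -(ν : ℂ) - n := by push_cast; ring
    rw [this, cpow_sub _ _ h0, cpow_natCast, div_pow]
    ring
  have hexp : ∀ t : ℝ, ‖cexp (2 * π * x * (Y + t * I))‖ = Real.exp (2 * π * x * Y) := fun t => by
    rw [norm_exp]
    congr 1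
    have : (2 * π * x * (Y + t * I) : ℂ) = ((2 * π * x : ℝ) : ℂ) * (Y + t * I) := by push_cast; rfl
    rw [this, re_ofReal_mul]
    simp
  have hint : ∀ n : ℕ, Integrable fun t : ℝ => ((Y : ℂ) + t * I) ^ (-(ν : ℂ)) *
      cexp (2 * π * x * (Y + t * I)) * ((B / (Y + t * I)) ^ n / n.factorial) := fun n => by
    simp_rw [hcpow n]
    refine Integrable.const_mul ?_ _
    refine (integrable_cpow_add_mul_I (ν := ν + n) (by linarith [n.cast_nonneg (α := ℝ)]) hY).mul_bdd
      (c := Real.exp (2 * π * x * Y)) ?_ ?_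
    · exact Continuous.aestronglyMeasurable (by fun_prop)
    · exact Filter.Eventually.of_forall fun t => (hexp t).le
  have hsum : Summable fun n : ℕ => ∫ t : ℝ, ‖((Y : ℂ) + t * I) ^ (-(ν : ℂ)) *
      cexp (2 * π * x * (Y + t * I)) * ((B / (Y + t * I)) ^ n / n.factorial)‖ := by
    refine Summable.of_nonneg_of_le (fun n => integral_nonneg fun t => norm_nonneg _) (fun n => ?_)
      ((Real.summable_pow_div_factorial (|B| / Y)).mul_left
        (∫ t : ℝ, ‖(Y : ℂ) + t * I‖ ^ (-ν) * Real.exp (2 * π * x * Y)))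
    rw [← integral_mul_const]
    refine integral_mono (hint n).norm
      (((integrable_norm_rpow_add_mul_I hν hY).mul_const _).mul_const _) fun t => ?_
    simp only
    have h1 := norm_cpow_add_mul_I hY (-ν) t
    rw [ofReal_neg] at h1
    rw [norm_mul, norm_mul, h1, hexp, norm_div, norm_pow, norm_div, norm_real, Real.norm_eq_abs,
      norm_natCast]
    gcongr
    exact le_norm_add_mul_I t
  have key := hasSum_integral_of_summable_integral_norm hint hsum
  have hexp2 : ∀ t : ℝ, ∑' n : ℕ, ((Y : ℂ) + t * I) ^ (-(ν : ℂ)) *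
      cexp (2 * π * x * (Y + t * I)) * ((B / (Y + t * I)) ^ n / n.factorial) =
      ((Y : ℂ) + t * I) ^ (-(ν : ℂ)) * cexp (2 * π * x * (Y + t * I)) * cexp (B / (Y + t * I)) :=
    fun t => by
      rw [tsum_mul_left, Complex.exp_eq_exp_ℂ, NormedSpace.exp_eq_tsum_div]
  simp_rw [hexp2] at key
  rw [← key.tsum_eq, besselL, ← tsum_mul_left]
  refine tsum_congr fun n => ?_
  simp_rw [hcpow n]
  rw [integral_const_mul, integral_cpow_mul_exp (by linarith [n.cast_nonneg (α := ℝ)]) hY]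
  have h2 : (2 * π) ^ (ν + n) = (2 * π) ^ ν * (2 * π) ^ n := by
    rw [Real.rpow_add (by positivity), Real.rpow_natCast]
  -- For `x ≤ 0` both exponents of `max x 0` are positive, so both sides vanish, including at `n =
  -- 0`.
  have h3 : max x 0 ^ (ν + n - 1) = max x 0 ^ (ν - 1) * x ^ n := by
    rcases le_or_gt x 0 with hx | hx
    · rw [max_eq_right hx, Real.zero_rpow (by linarith [n.cast_nonneg (α := ℝ)]),
        Real.zero_rpow (by linarith), zero_mul]
    · rw [max_eq_left hx.le, show ν + n - 1 = (ν - 1) + n by ring, Real.rpow_add hx,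
        Real.rpow_natCast]
  have h4 : (n : ℂ) + (ν - 1) + 1 = ((ν + n : ℝ) : ℂ) := by push_cast; ring
  rw [h2, h3, h4, Gamma_ofReal]
  push_cast
  rw [mul_pow, mul_pow, mul_pow]
  ring

end ModularExpansion

namespace ModularExpansion

open Complex MeasureTheory ModularForm
open UpperHalfPlane hiding I

/-! ## Sums over cosets of a form of weight two -/

theorem ofComplex_neg_inv {w : ℂ} (hw : 0 < w.im) :
    ofComplex (-w⁻¹) = ModularGroup.S • ofComplex w := by
  rw [modular_S_smul]
  ext1
  have h1 : 0 < (-w⁻¹).im := by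
    rw [neg_im, inv_im, neg_div, neg_neg]
    have : 0 < normSq w := normSq_pos.2 fun h => by simp [h] at hw
    positivity
  rw [ofComplex_apply_of_im_pos h1, ofComplex_apply_of_im_pos hw]
  simp [inv_neg]

theorem differentiableOn_slash_comp_ofComplex {φ : ℍ → ℂ} (hφ : MDifferentiable 𝓘(ℂ) 𝓘(ℂ) φ)
    (g : SL(2, ℤ)) : DifferentiableOn ℂ (fun w => (φ ∣[(2 : ℤ)] g) (ofComplex w)) {z | 0 < z.im} :=
  UpperHalfPlane.mdifferentiable_iff.1 (hφ.slash 2 (g : GL (Fin 2) ℝ))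

/-- The sum of a form of weight two over a system of representatives of `H \ SL(2, ℤ)` is
invariant, so that its integral over a period vanishes. -/
theorem hasSum_integral_slash {H : Subgroup SL(2, ℤ)} {φ : ℍ → ℂ}
    (hφ : MDifferentiable 𝓘(ℂ) 𝓘(ℂ) φ) (hinv : ∀ g ∈ H, φ ∣[(2 : ℤ)] g = φ) {ι : Type*} [Countable ι]
    {r : ι → SL(2, ℤ)} (hr : Function.Bijective fun i => QuotientGroup.mk (s := H) (r i)⁻¹) {u : ι → ℝ}
    (hu : Summable u)
    (hb : ∀ i (z : ℍ), (z : ℂ) ∈ hypDisc → ‖(φ ∣[(2 : ℤ)] r i) z‖ ≤ u i) :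
    HasSum (fun i => ∫ t in (-(1 / 2) : ℝ)..(1 / 2),
      (φ ∣[(2 : ℤ)] r i) (ofComplex (t + (√3 / 2 : ℝ) * I))) 0 := by
  have hb' : ∀ i, ∀ w ∈ hypDisc, ‖(φ ∣[(2 : ℤ)] r i) (ofComplex w)‖ ≤ u i := fun i w hw => by
    refine hb i _ ?_
    rwa [ofComplex_apply_of_im_pos (im_pos_of_mem_hypDisc hw)]
  have hd : ∀ i, DifferentiableOn ℂ (fun w => (φ ∣[(2 : ℤ)] r i) (ofComplex w)) hypDisc := fun i =>
    (differentiableOn_slash_comp_ofComplex hφ _).mono fun w hw => im_pos_of_mem_hypDisc hw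
  have hs : ∀ w ∈ hypDisc, Summable fun i => (φ ∣[(2 : ℤ)] r i) (ofComplex w) := fun w hw =>
    Summable.of_norm_bounded hu fun i => hb' i w hw
  have key := integral_eq_zero_of_weight_two (F := fun w => ∑' i, (φ ∣[(2 : ℤ)] r i) (ofComplex w))
    (differentiableOn_tsum_of_summable_norm hu hd isOpen_hypDisc hb') (by
      intro w hw
      have hwim := im_pos_of_mem_hypDisc hw
      set e := Equiv.ofBijective _ hr with he
      -- Right multiplication by `S` permutes the right cosets of `H`. Passing to inverses turns
      -- these into the left cosets of `SL(2, ℤ) ⧸ H`, where `S⁻¹` acts on the left.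
      set σ : ι ≃ ι := e.trans ((MulAction.toPerm (ModularGroup.S)⁻¹).trans e.symm) with hσ
      have hperm : ∀ i, φ ∣[(2 : ℤ)] (r i * ModularGroup.S) = φ ∣[(2 : ℤ)] r (σ i) := fun i => by
        have h1 : QuotientGroup.mk (s := H) (r i * ModularGroup.S)⁻¹ =
            QuotientGroup.mk (r (σ i))⁻¹ := by
          have h2 : e (σ i) = (ModularGroup.S)⁻¹ • e i := by simp [hσ]
          have h3 : e (σ i) = QuotientGroup.mk (r (σ i))⁻¹ := rfl
          rw [← h3, h2, mul_inv_rev]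
          rfl
        rw [QuotientGroup.eq, inv_inv] at h1
        have h4 : r i * ModularGroup.S = (r i * ModularGroup.S * (r (σ i))⁻¹) * r (σ i) := by group
        rw [h4, SlashAction.slash_mul, hinv _ h1]
      rw [← tsum_mul_left, ← σ.tsum_eq (fun i => w ^ 2 * _)]
      refine tsum_congr fun i => ?_
      rw [← hperm, SlashAction.slash_mul, SL_slash_apply (γ := ModularGroup.S),
        ofComplex_neg_inv hwim, ModularGroup.denom_S, ofComplex_apply_of_im_pos hwim]
      have := ne_zero_of_mem_hypDisc hw
      change _ = w ^ 2 * (_ * w ^ (-2 : ℤ))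
      field_simp)
  rw [← key]
  have hmem : ∀ t ∈ Set.uIoc (-(1 / 2) : ℝ) (1 / 2), (t : ℂ) + (√3 / 2 : ℝ) * I ∈ hypDisc :=
    fun t ht => by
      rw [Set.uIoc_of_le (by norm_num)] at ht
      exact add_sqrt_mul_I_mem_hypDisc ⟨ht.1.le, ht.2⟩
  refine intervalIntegral.hasSum_integral_of_dominated_convergence (fun i _ => u i) (fun i => ?_)
    (fun i => ?_) ?_ ?_ ?_
  · refine ContinuousOn.aestronglyMeasurable ?_ measurableSet_uIoc
    exact (hd i).continuousOn.comp (by fun_prop) hmem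
  · exact Filter.Eventually.of_forall fun t ht => hb' i _ (hmem t ht)
  · exact Filter.Eventually.of_forall fun t _ => hu
  · exact intervalIntegrable_const
  · exact Filter.Eventually.of_forall fun t ht => (hs _ (hmem t ht)).hasSum

/-! ## Representatives of the cosets of the translations -/

theorem inv_apply (g : SL(2, ℤ)) :
    g⁻¹ 0 0 = g 1 1 ∧ g⁻¹ 0 1 = -g 0 1 ∧ g⁻¹ 1 0 = -g 1 0 ∧ g⁻¹ 1 1 = g 0 0 := by
  simp [Matrix.SpecialLinearGroup.coe_inv, Matrix.adjugate_fin_two]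

theorem mul_entries (a b : SL(2, ℤ)) :
    (a * b) 0 0 = a 0 0 * b 0 0 + a 0 1 * b 1 0 ∧ (a * b) 0 1 = a 0 0 * b 0 1 + a 0 1 * b 1 1 ∧
    (a * b) 1 0 = a 1 0 * b 0 0 + a 1 1 * b 1 0 ∧
    (a * b) 1 1 = a 1 0 * b 0 1 + a 1 1 * b 1 1 := by
  simp [Matrix.mul_apply, Fin.sum_univ_two]

/-- The matrices `± (1 b; 0 1)` with `b` divisible by `h`. -/
def translations (h : ℕ) : Subgroup SL(2, ℤ) where
  carrier := {g | g 1 0 = 0 ∧ (h : ℤ) ∣ g 0 1}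
  one_mem' := by simp
  mul_mem' := by
    rintro a b ⟨ha, ha'⟩ ⟨hb, hb'⟩
    refine ⟨by rw [(mul_entries a b).2.2.1, ha, hb, zero_mul, mul_zero, add_zero], ?_⟩
    rw [(mul_entries a b).2.1]
    exact dvd_add (hb'.mul_left _) (ha'.mul_right _)
  inv_mem' := by
    rintro a ⟨ha, ha'⟩
    have := inv_apply a
    exact ⟨by rw [this.2.2.1, ha, neg_zero], by rw [this.2.1]; exact ha'.neg_right⟩

theorem mem_translations {h : ℕ} {g : SL(2, ℤ)} :
    g ∈ translations h ↔ g 1 0 = 0 ∧ (h : ℤ) ∣ g 0 1 := Iff.rfl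

theorem det_eq_one (g : SL(2, ℤ)) : g 0 0 * g 1 1 - g 0 1 * g 1 0 = 1 := by
  have := g.det_coe
  rwa [Matrix.det_fin_two] at this

theorem eq_or_eq_neg_T_zpow {g : SL(2, ℤ)} (hg : g 1 0 = 0) :
    (g = ModularGroup.T ^ (g 0 1)) ∨ g = -ModularGroup.T ^ (-g 0 1) := by
  have hdet := det_eq_one g
  rw [hg, mul_zero, sub_zero] at hdet
  rcases Int.mul_eq_one_iff_eq_one_or_neg_one.1 hdet with h | h
  · left
    ext i j
    rw [ModularGroup.coe_T_zpow]
    fin_cases i <;> fin_cases j <;> simp [h.1, h.2, hg]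
  · right
    ext i j
    rw [Matrix.SpecialLinearGroup.coe_neg, ModularGroup.coe_T_zpow]
    fin_cases i <;> fin_cases j <;> simp [h.1, h.2, hg]

theorem vadd_intCast_mul_eq {φ : ℍ → ℂ} {h : ℝ} (hφ : ∀ z : ℍ, φ (h +ᵥ z) = φ z) (n : ℤ) (z : ℍ) :
    φ ((n * h : ℝ) +ᵥ z) = φ z := by
  induction n using Int.induction_on with
  | zero => simp
  | succ n ih =>
    rw [← ih, ← hφ ((((n : ℤ) : ℝ) * h) +ᵥ z), vadd_vadd]
    push_cast
    ring_nf
  | pred n ih =>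
    rw [← ih, ← hφ ((((-n - 1 : ℤ) : ℝ) * h) +ᵥ z), vadd_vadd]
    push_cast
    ring_nf

/-- The weight is even, so `-1` acts trivially and the sign in `± T ^ (h n)` is harmless. -/
theorem slash_translations {φ : ℍ → ℂ} {h : ℕ} (hφ : ∀ z : ℍ, φ ((h : ℝ) +ᵥ z) = φ z) :
    ∀ g ∈ translations h, φ ∣[(2 : ℤ)] g = φ := by
  have hT : ∀ n : ℤ, φ ∣[(2 : ℤ)] (ModularGroup.T ^ (h * n)) = φ := fun n => by
    ext z
    rw [SL_slash_apply, modular_T_zpow_smul, ModularGroup.denom_apply, ModularGroup.coe_T_zpow]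
    have := vadd_intCast_mul_eq hφ n z
    simp only [Int.cast_mul, Int.cast_natCast]
    rw [mul_comm (h : ℝ), this]
    simp
  rintro g ⟨hg, n, hn⟩
  rcases eq_or_eq_neg_T_zpow hg with h1 | h1
  · rw [h1, hn]
    exact hT n
  · rw [hn, ← mul_neg] at h1
    rw [h1]
    refine Eq.trans ?_ (hT (-n))
    ext z
    rw [SL_slash_apply, SL_slash_apply, ModularGroup.SL_neg_smul, ModularGroup.denom_apply,
      ModularGroup.denom_apply, ModularGroup.coe_T_zpow, Matrix.SpecialLinearGroup.coe_neg,
      ModularGroup.coe_T_zpow]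
    simp

/-- Representatives of `translations h \ SL(2, ℤ)`, given a matrix `γ x` with `γ x ∞ = x` for each
rational `x`. -/
def cosetRep (h : ℕ) (γ : ℚ → SL(2, ℤ)) : Fin h ⊕ ({x : ℚ // 0 ≤ x ∧ x < h} × ℤ) → SL(2, ℤ)
  | .inl j => ModularGroup.T ^ (j : ℤ)
  | .inr p => γ p.1 * ModularGroup.T ^ p.2

theorem mul_T_zpow_apply (g : SL(2, ℤ)) (n : ℤ) :
    (g * ModularGroup.T ^ n) 0 0 = g 0 0 ∧ (g * ModularGroup.T ^ n) 0 1 = g 0 0 * n + g 0 1 ∧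
    (g * ModularGroup.T ^ n) 1 0 = g 1 0 ∧ (g * ModularGroup.T ^ n) 1 1 = g 1 0 * n + g 1 1 := by
  simp [Matrix.mul_apply, Fin.sum_univ_two, ModularGroup.coe_T_zpow]

theorem T_zpow_mul_apply (g : SL(2, ℤ)) (n : ℤ) :
    (ModularGroup.T ^ n * g) 0 0 = g 0 0 + n * g 1 0 ∧
    (ModularGroup.T ^ n * g) 0 1 = g 0 1 + n * g 1 1 ∧
    (ModularGroup.T ^ n * g) 1 0 = g 1 0 ∧ (ModularGroup.T ^ n * g) 1 1 = g 1 1 := by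
  simp [Matrix.mul_apply, Fin.sum_univ_two, ModularGroup.coe_T_zpow]

/-- The matrix `γ` maps `∞` to `x`, and its lower left entry is positive. -/
def MapsInftyTo (γ : SL(2, ℤ)) (x : ℚ) : Prop :=
  0 < γ 1 0 ∧ x = ((γ 0 0 : ℤ) : ℚ) / ((γ 1 0 : ℤ) : ℚ)

theorem isCoprime_col (g : SL(2, ℤ)) : IsCoprime (g 0 0) (g 1 0) :=
  ⟨g 1 1, -g 0 1, by linear_combination det_eq_one g⟩

/-- The determinant makes the first column coprime, so `a / c` with `c > 0` is already reduced. Thus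
`c` does not depend on the choice of `γ`. -/
theorem MapsInftyTo.num_den {γ : SL(2, ℤ)} {x : ℚ} (hγ : MapsInftyTo γ x) :
    γ 0 0 = x.num ∧ γ 1 0 = x.den := by
  have hcop : Nat.Coprime (γ 0 0).natAbs (γ 1 0).natAbs :=
    Int.isCoprime_iff_gcd_eq_one.1 (isCoprime_col γ)
  exact ⟨by rw [hγ.2, Rat.num_div_eq_of_coprime hγ.1 hcop],
    by rw [hγ.2, Rat.den_div_eq_of_coprime hγ.1 hcop]⟩

/-- Both matrices have the same first column, so `γ⁻¹ * g` fixes `∞` and has upper left entry `1`;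
this excludes the negative sign. -/
theorem MapsInftyTo.exists_eq_mul_T_zpow {γ g : SL(2, ℤ)} {x : ℚ} (hγ : MapsInftyTo γ x)
    (hg : MapsInftyTo g x) : ∃ m : ℤ, g = γ * ModularGroup.T ^ m := by
  have h1 := hγ.num_den
  have h2 := hg.num_den
  have hc : (γ⁻¹ * g) 1 0 = 0 := by
    rw [(mul_entries _ _).2.2.1, (inv_apply γ).2.2.1, (inv_apply γ).2.2.2, h2.1, h2.2, ← h1.1, ← h1.2]
    ring
  have ha : (γ⁻¹ * g) 0 0 = 1 := by
    rw [(mul_entries _ _).1, (inv_apply γ).1, (inv_apply γ).2.1, h2.1, h2.2, ← h1.1, ← h1.2]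
    linear_combination det_eq_one γ
  refine ⟨(γ⁻¹ * g) 0 1, ?_⟩
  rcases eq_or_eq_neg_T_zpow hc with h3 | h3
  · rw [← h3]; group
  · have h4 : (γ⁻¹ * g) 0 0 = (-ModularGroup.T ^ (-(γ⁻¹ * g) 0 1)) 0 0 := by rw [← h3]
    rw [ha, Matrix.SpecialLinearGroup.coe_neg, ModularGroup.coe_T_zpow] at h4
    simp at h4

/-- Left multiplication by `± T ^ (h n)` moves the cusp `g ∞` by a multiple of `h`. If `c = 0`, only
the power of `T` modulo `h` remains. Otherwise the sign is fixed by `c > 0`, the cusp can be moved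
to a unique `x` in `[0, h)`, and then `g = γ x * T ^ m` for a unique `m`. -/
theorem bijective_cosetRep {h : ℕ} (hh : 0 < h) {γ : ℚ → SL(2, ℤ)} (hγ : ∀ x, MapsInftyTo (γ x) x) :
    Function.Bijective fun i => QuotientGroup.mk (s := translations h) (cosetRep h γ i)⁻¹ := by
  have hhZ : (0 : ℤ) < h := by exact_mod_cast hh
  constructor
  · intro i j hij
    simp only at hij
    rw [QuotientGroup.eq, inv_inv] at hij
    obtain ⟨t, ht, hij⟩ : ∃ t ∈ translations h, cosetRep h γ i = t * cosetRep h γ j :=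
      ⟨_, hij, by group⟩
    obtain ⟨n, hn⟩ := ht.2
    have hn' : ∃ n : ℤ, cosetRep h γ i = ModularGroup.T ^ (h * n) * cosetRep h γ j ∨
        cosetRep h γ i = -(ModularGroup.T ^ (h * n) * cosetRep h γ j) := by
      rcases eq_or_eq_neg_T_zpow ht.1 with h1 | h1
      · exact ⟨n, Or.inl (by rw [hij, ← hn, ← h1])⟩
      · refine ⟨-n, Or.inr ?_⟩
        rw [hij, mul_neg, ← hn]
        conv_lhs => rw [h1]
        rw [neg_mul]
    clear hij hn n
    obtain ⟨n, hn⟩ := hn'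
    have hT := T_zpow_mul_apply (cosetRep h γ j) (h * n)
    -- First columns suffice to exclude the sign `-1` and equality across the two families. The full
    -- matrix identity is kept for the sign `+1`, where `j` or `m` is still to be recovered.
    have hcol : ((cosetRep h γ i 0 0 = cosetRep h γ j 0 0 + h * n * cosetRep h γ j 1 0 ∧
        cosetRep h γ i 1 0 = cosetRep h γ j 1 0) ∧
        cosetRep h γ i = ModularGroup.T ^ (h * n) * cosetRep h γ j) ∨
        (cosetRep h γ i 0 0 = -(cosetRep h γ j 0 0 + h * n * cosetRep h γ j 1 0) ∧
        cosetRep h γ i 1 0 = -cosetRep h γ j 1 0) := by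
      rcases hn with hn | hn
      · left
        refine ⟨⟨?_, ?_⟩, hn⟩
        · rw [hn, hT.1]
        · rw [hn, hT.2.2.1]
      · right
        refine ⟨?_, ?_⟩
        · rw [hn, Matrix.SpecialLinearGroup.coe_neg, Matrix.neg_apply, hT.1]
        · rw [hn, Matrix.SpecialLinearGroup.coe_neg, Matrix.neg_apply, hT.2.2.1]
    have hinl : ∀ j, cosetRep h γ (.inl j) 0 0 = 1 ∧ cosetRep h γ (.inl j) 1 0 = 0 ∧
        cosetRep h γ (.inl j) 0 1 = j := fun j => by
      simp only [cosetRep, ModularGroup.coe_T_zpow]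
      simp
    have hinr : ∀ x m, cosetRep h γ (.inr (x, m)) 0 0 = γ x 0 0 ∧
        cosetRep h γ (.inr (x, m)) 1 0 = γ x 1 0 := fun x m =>
      ⟨(mul_T_zpow_apply (γ x) m).1, (mul_T_zpow_apply (γ x) m).2.2.1⟩
    rcases i with i | ⟨x, m⟩ <;> rcases j with j | ⟨y, m'⟩
    · rw [(hinl i).1, (hinl j).1, (hinl i).2.1, (hinl j).2.1] at hcol
      rcases hcol with hcol | hcol
      · have h1 := (hinl i).2.2
        rw [hcol.2, hT.2.1, (hinl j).2.2] at h1
        have h2 : cosetRep h γ (.inl j) 1 1 = 1 := by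
          simp only [cosetRep, ModularGroup.coe_T_zpow]
          simp
        rw [h2, mul_one] at h1
        have hi : ((i : ℕ) : ℤ) % h = i := Int.emod_eq_of_lt (by positivity) (by exact_mod_cast i.2)
        have hj : ((j : ℕ) : ℤ) % h = j := Int.emod_eq_of_lt (by positivity) (by exact_mod_cast j.2)
        rw [← h1, Int.add_mul_emod_self_left, hj, h1] at hi
        congr 1
        ext
        exact_mod_cast hi.symm
      · simp at hcol
    · have := (hγ y).1
      rw [(hinl i).2.1, (hinr y m').2] at hcol
      omega
    · have := (hγ x).1
      rw [(hinl j).2.1, (hinr x m).2] at hcol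
      omega
    · have hx := hγ x
      have hy := hγ y
      have hx0 := hx.1
      have hy0 := hy.1
      rw [(hinr x m).1, (hinr x m).2, (hinr y m').1, (hinr y m').2] at hcol
      rcases hcol with ⟨⟨h1, h2⟩, h3⟩ | hcol
      · have h4 : (x : ℚ) = y + h * n := by
          have hy0' : ((γ y 1 0 : ℤ) : ℚ) ≠ 0 := by exact_mod_cast hy0.ne'
          rw [hx.2, hy.2, h1, h2]
          push_cast
          field_simp
        have hn0 : n = 0 := by
          have hx1 := x.2
          have hy1 := y.2
          have hhQ : (0 : ℚ) < h := by exact_mod_cast hh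
          have h5 : (h : ℚ) * n < h * 1 := by linarith
          have h6 : (h : ℚ) * (-1) < h * n := by linarith
          have h7 := lt_of_mul_lt_mul_left h5 hhQ.le
          have h8 := lt_of_mul_lt_mul_left h6 hhQ.le
          have h7' : n < 1 := by exact_mod_cast h7
          have h8' : -1 < n := by exact_mod_cast h8
          omega
        subst hn0
        have hxy : x = y := Subtype.ext (by simpa using h4)
        subst hxy
        have h5 : cosetRep h γ (.inr (x, m)) 1 1 = cosetRep h γ (.inr (x, m')) 1 1 := by
          rw [h3]; simp
        have h6 : γ x 1 0 * m + γ x 1 1 = γ x 1 0 * m' + γ x 1 1 :=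
          ((mul_T_zpow_apply (γ x) m).2.2.2).symm.trans
            (h5.trans (mul_T_zpow_apply (γ x) m').2.2.2)
        have h7 : m = m' := mul_left_cancel₀ hx0.ne' (add_right_cancel h6)
        rw [h7]
      · omega
  · intro q
    induction q using QuotientGroup.induction_on with
    | H g =>
    obtain ⟨g, rfl⟩ : ∃ g', g = g'⁻¹ := ⟨g⁻¹, by simp⟩
    simp only [QuotientGroup.eq, inv_inv]
    have hneg : ∀ g ∈ translations h, -g ∈ translations h := fun g hg => by
      rw [mem_translations, Matrix.SpecialLinearGroup.coe_neg, Matrix.neg_apply, Matrix.neg_apply]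
      exact ⟨by rw [hg.1, neg_zero], hg.2.neg_right⟩
    have hTmem : ∀ n : ℤ, (h : ℤ) ∣ n → ModularGroup.T ^ n ∈ translations h := fun n hn => by
      rw [mem_translations, ModularGroup.coe_T_zpow]
      simpa using hn
    have hTcase : ∀ n : ℤ, ∃ i, cosetRep h γ i * (ModularGroup.T ^ n)⁻¹ ∈ translations h :=
      fun n => by
        have h0 := Int.emod_nonneg n hhZ.ne'
        have h1 := Int.emod_lt_of_pos n hhZ
        refine ⟨.inl ⟨(n % h).toNat, by omega⟩, ?_⟩
        rw [← zpow_neg]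
        simp only [cosetRep]
        rw [← zpow_add, Int.toNat_of_nonneg h0]
        refine hTmem _ ?_
        rw [← sub_eq_add_neg, ← neg_sub, dvd_neg]
        exact Int.dvd_self_sub_emod
    have hpos : ∀ g : SL(2, ℤ), 0 < g 1 0 → ∃ i, cosetRep h γ i * g⁻¹ ∈ translations h :=
      fun g hg => by
        set x₀ : ℚ := ((g 0 0 : ℤ) : ℚ) / ((g 1 0 : ℤ) : ℚ) with hx₀
        have hhQ : (0 : ℚ) < h := by exact_mod_cast hh
        -- `T ^ (-(n * h))` brings the cusp `x₀` into `[0, h)`.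
        set n : ℤ := ⌊x₀ / h⌋ with hn
        have h1 : (n : ℚ) ≤ x₀ / h := Int.floor_le _
        have h2 : x₀ / h < n + 1 := Int.lt_floor_add_one _
        rw [le_div_iff₀ hhQ] at h1
        rw [div_lt_iff₀ hhQ] at h2
        set x : {x : ℚ // 0 ≤ x ∧ x < h} := ⟨x₀ - n * h, by linarith, by linarith⟩ with hx
        have hT := T_zpow_mul_apply g (-(n * h))
        have hmaps : MapsInftyTo (ModularGroup.T ^ (-(n * h)) * g) x := by
          refine ⟨by rw [hT.2.2.1]; exact hg, ?_⟩
          have hg' : ((g 1 0 : ℤ) : ℚ) ≠ 0 := by exact_mod_cast hg.ne'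
          rw [hT.1, hT.2.2.1]
          change x₀ - n * h = _
          rw [hx₀]
          push_cast
          field_simp
          ring
        obtain ⟨m, hm⟩ := (hγ x).exists_eq_mul_T_zpow hmaps
        refine ⟨.inr (x, m), ?_⟩
        simp only [cosetRep]
        rw [← hm, mul_inv_cancel_right]
        exact hTmem _ (by simp)
    have hinvneg : ∀ a g : SL(2, ℤ), a * (-g)⁻¹ = -(a * g⁻¹) := fun a g => by
      rw [inv_neg, mul_neg]
    rcases lt_trichotomy (g 1 0) 0 with hg | hg | hg
    · obtain ⟨i, hi⟩ := hpos (-g) (by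
        rw [Matrix.SpecialLinearGroup.coe_neg, Matrix.neg_apply]; omega)
      refine ⟨i, ?_⟩
      rw [hinvneg] at hi
      simpa using hneg _ hi
    · rcases eq_or_eq_neg_T_zpow hg with h1 | h1
      · rw [h1]
        exact hTcase _
      · obtain ⟨i, hi⟩ := hTcase (-g 0 1)
        refine ⟨i, ?_⟩
        rw [h1, hinvneg]
        exact hneg _ hi
    · exact hpos g hg

end ModularExpansion

namespace ModularExpansion

open Complex MeasureTheory ModularForm
open UpperHalfPlane hiding I

/-! ## The factor of automorphy and the growth of modular functions -/

/-- The factor `c z + d`. -/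
def autFactor (g : SL(2, ℤ)) (z : ℍ) : ℂ := ((g 1 0 : ℤ) : ℂ) * z + ((g 1 1 : ℤ) : ℂ)

theorem autFactor_eq_denom (g : SL(2, ℤ)) (z : ℍ) : autFactor g z = denom g z := rfl

theorem autFactor_ne_zero (g : SL(2, ℤ)) (z : ℍ) : autFactor g z ≠ 0 :=
  denom_ne_zero (g : GL (Fin 2) ℝ) z

theorem coe_smul_eq_div (g : SL(2, ℤ)) (z : ℍ) :
    ((g • z : ℍ) : ℂ) = (((g 0 0 : ℤ) : ℂ) * z + ((g 0 1 : ℤ) : ℂ)) / autFactor g z := by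
  rw [coe_specialLinearGroup_apply]
  simp [autFactor]

theorem autFactor_mul (g g' : SL(2, ℤ)) (z : ℍ) :
    autFactor (g * g') z = autFactor g (g' • z) * autFactor g' z := by
  have h0 := autFactor_ne_zero g' z
  have h1 : autFactor g (g' • z) = ((g 1 0 : ℤ) : ℂ) * ((g' • z : ℍ) : ℂ) + ((g 1 1 : ℤ) : ℂ) := rfl
  have hm := mul_entries g g'
  rw [h1, coe_smul_eq_div, add_mul, mul_div_assoc', div_mul_cancel₀ _ h0, autFactor, autFactor,
    hm.2.2.1, hm.2.2.2]
  push_cast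
  ring

theorem continuous_autFactor (g : SL(2, ℤ)) : Continuous (autFactor g) := by
  unfold autFactor
  fun_prop

/-- On the disc `1/2 < Im z < 2`. If `c = 0`, then `|d| = 1` and the height is unchanged; otherwise
`|cz + d| ≥ Im z`, so the new height is at most `1 / Im z`. This bounds the exponential factor of
`twist` uniformly in `g`. -/
theorem im_smul_le {g : SL(2, ℤ)} {z : ℍ} (hz : (z : ℂ) ∈ hypDisc) : (g • z).im ≤ 2 := by
  have h1 := mem_hypDisc_iff.1 hz
  rw [normSq_apply] at h1
  have h0 := z.im_pos
  change _ + z.im * z.im + 1 < 5 / 2 * z.im at h1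
  have hre : 0 ≤ (z : ℂ).re * (z : ℂ).re := mul_self_nonneg _
  have h2 : z.im < 2 := by nlinarith
  have h3 : 1 / 2 < z.im := by nlinarith
  rw [ModularGroup.im_smul_eq_div_normSq, ← autFactor_eq_denom, div_le_iff₀
    (normSq_pos.2 (autFactor_ne_zero g z)), autFactor, normSq_apply]
  have hre' : (((g 1 0 : ℤ) : ℂ) * z + ((g 1 1 : ℤ) : ℂ)).re = g 1 0 * z.re + g 1 1 := by simp
  have him' : (((g 1 0 : ℤ) : ℂ) * z + ((g 1 1 : ℤ) : ℂ)).im = g 1 0 * z.im := by simp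
  rw [hre', him']
  by_cases hc : g 1 0 = 0
  · have hdet := det_eq_one g
    rw [hc, mul_zero, sub_zero] at hdet
    have hd : g 1 1 * g 1 1 = 1 := by
      rcases Int.mul_eq_one_iff_eq_one_or_neg_one.1 hdet with h | h <;> simp [h.2]
    have hd' : ((g 1 1 : ℤ) : ℝ) * ((g 1 1 : ℤ) : ℝ) = 1 := by exact_mod_cast hd
    rw [hc]
    simp only [Int.cast_zero, zero_mul, zero_add, mul_zero, add_zero]
    rw [hd']
    linarith
  · have hc1 : 1 ≤ g 1 0 * g 1 0 := by
      have : 0 < g 1 0 * g 1 0 := mul_self_pos.2 hc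
      omega
    have hc' : (1 : ℝ) ≤ ((g 1 0 : ℤ) : ℝ) * ((g 1 0 : ℤ) : ℝ) := by exact_mod_cast hc1
    have h4 : z.im ≤ 2 * (z.im * z.im) := by nlinarith
    have h5 : z.im * z.im ≤ (((g 1 0 : ℤ) : ℝ) * ((g 1 0 : ℤ) : ℝ)) * (z.im * z.im) :=
      le_mul_of_one_le_left (by positivity) hc'
    nlinarith [mul_self_nonneg (((g 1 0 : ℤ) : ℝ) * z.re + ((g 1 1 : ℤ) : ℝ))]

theorem mem_verticalStrip_of_mem_hypDisc {z : ℍ} (hz : (z : ℂ) ∈ hypDisc) :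
    z ∈ verticalStrip 1 (1 / 2) := by
  have h1 := mem_hypDisc_iff.1 hz
  rw [normSq_apply] at h1
  change z.re * z.re + z.im * z.im + 1 < 5 / 2 * z.im at h1
  rw [mem_verticalStrip_iff]
  refine ⟨abs_le.2 ⟨?_, ?_⟩, ?_⟩ <;> nlinarith [sq_nonneg (z.im - 5 / 4), mul_self_nonneg z.re]

theorem isCompact_closure_hypDisc : IsCompact {z : ℍ | (z : ℂ) ∈ closure hypDisc} := by
  have h1 : IsCompact (closure hypDisc) := by
    rw [hypDisc, closure_ball _ (by norm_num)]
    exact isCompact_closedBall _ _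
  refine UpperHalfPlane.isOpenEmbedding_coe.isInducing.isCompact_preimage' h1 fun w hw => ?_
  replace hw := Metric.closure_ball_subset_closedBall hw
  rw [Metric.mem_closedBall, Complex.dist_eq] at hw
  have h2 : |(w - 5 / 4 * I).im| ≤ 3 / 4 := (abs_im_le_norm _).trans hw
  have h3 : (w - 5 / 4 * I).im = w.im - 5 / 4 := by
    have : (5 / 4 : ℂ) = ((5 / 4 : ℝ) : ℂ) := by norm_num
    rw [sub_im, this, im_ofReal_mul, Complex.I_im, mul_one]
  rw [h3] at h2
  have := (abs_le.1 h2).1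
  exact ⟨⟨w, by linarith⟩, rfl⟩

/-- A modular function `f` of weight `k` is `O (|c z + d| ^ k)` at `g z`, uniformly in `g`. -/
theorem exists_norm_smul_le {Γ : Subgroup SL(2, ℤ)} [Γ.FiniteIndex] {k : ℝ} {f : ℍ → ℂ}
    (hf : IsHolomorphicModularFunction Γ k f) :
    ∃ M : ℝ, 0 ≤ M ∧ ∀ (g : SL(2, ℤ)) (z : ℍ), (z : ℂ) ∈ hypDisc →
      ‖f (g • z)‖ ≤ M * ‖autFactor g z‖ ^ k := by
  -- `N` is invariant under `Γ` on the left in `g`, so finitely many `g` suffice, and for each of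
  -- them continuity on a compact set gives a bound.
  set N : SL(2, ℤ) → ℍ → ℝ := fun g z => ‖f (g • z)‖ * ‖autFactor g z‖ ^ (-k) with hN
  have hinv : ∀ γ ∈ Γ, ∀ g z, N (γ * g) z = N g z := fun γ hγ g z => by
    obtain ⟨j, -, hj, hfj⟩ := hf.automorphy γ hγ
    have h1 : ‖j (g • z)‖ = ‖autFactor γ (g • z)‖ ^ k := hj _
    have h2 : 0 < ‖autFactor γ (g • z)‖ := norm_pos_iff.2 (autFactor_ne_zero _ _)
    simp only [hN]
    rw [mul_smul, hfj, autFactor_mul, norm_mul, norm_mul, h1,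
      Real.mul_rpow (norm_nonneg _) (norm_nonneg _), Real.rpow_neg h2.le]
    have : ‖autFactor γ (g • z)‖ ^ k ≠ 0 := (Real.rpow_pos_of_pos h2 _).ne'
    field_simp
  have hcont : ∀ g, Continuous (N g) := fun g => by
    refine Continuous.mul ?_ ?_
    · refine continuous_norm.comp (hf.holo.continuous.comp ?_)
      exact (mdifferentiable_smul (g := (g : GL (Fin 2) ℝ)) (by simp)).continuous
    · exact Continuous.rpow_const (continuous_norm.comp (continuous_autFactor g)) fun z =>
        Or.inl (norm_ne_zero_iff.2 (autFactor_ne_zero g z))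
  have hbd : ∀ g, ∃ M, ∀ z : ℍ, (z : ℂ) ∈ hypDisc → N g z ≤ M := fun g => by
    obtain ⟨M, hM⟩ := isCompact_closure_hypDisc.bddAbove_image (hcont g).continuousOn
    exact ⟨M, fun z hz => hM ⟨z, subset_closure hz, rfl⟩⟩
  choose M hM using hbd
  have hfin : Finite (SL(2, ℤ) ⧸ Γ) := inferInstance
  obtain ⟨B, hB⟩ := (Set.finite_range fun q : SL(2, ℤ) ⧸ Γ => M (q.out)⁻¹).bddAbove
  refine ⟨max B 0, le_max_right _ _, fun g z hz => ?_⟩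
  have h0 : 0 < ‖autFactor g z‖ := norm_pos_iff.2 (autFactor_ne_zero _ _)
  obtain ⟨γ, hγ⟩ := QuotientGroup.mk_out_eq_mul Γ g⁻¹
  have h1 : N g z ≤ B := by
    have h2 : ((QuotientGroup.mk g⁻¹ : SL(2, ℤ) ⧸ Γ).out)⁻¹ = (γ : SL(2, ℤ))⁻¹ * g := by
      rw [hγ]; simp
    rw [← hinv _ (inv_mem γ.2), ← h2]
    exact (hM _ z hz).trans (hB ⟨_, rfl⟩)
  have h3 : ‖f (g • z)‖ = N g z * ‖autFactor g z‖ ^ k := by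
    simp only [hN]
    rw [mul_assoc, ← Real.rpow_add h0, neg_add_cancel, Real.rpow_zero, mul_one]
  rw [h3]
  gcongr
  exact h1.trans (le_max_left _ _)

/-- The product of `f` and `z ↦ exp (-2 π i lam z)`. -/
noncomputable def twist (f : ℍ → ℂ) (lam : ℝ) : ℍ → ℂ := fun z =>
  f z * cexp (-(2 * π * I * lam * z))

/-- The growth of `f` gives `|cz + d| ^ k`, the slash action gives `|cz + d| ^ (-2)`, and the
exponential is bounded. On a vertical strip `|cz + d|` is at least a constant times the norm of `(c,
d)`, which yields a majorant independent of `z`. -/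
theorem exists_norm_slash_twist_le {Γ : Subgroup SL(2, ℤ)} [Γ.FiniteIndex] {k : ℝ} (hk : k < 0)
    {f : ℍ → ℂ} (hf : IsHolomorphicModularFunction Γ k f) (lam : ℝ) :
    ∃ C : ℝ, ∀ (g : SL(2, ℤ)) (z : ℍ), (z : ℂ) ∈ hypDisc →
      ‖(twist f lam ∣[(2 : ℤ)] g) z‖ ≤ C * ‖![g 1 0, g 1 1]‖ ^ (-(2 - k)) := by
  obtain ⟨M, hM0, hM⟩ := exists_norm_smul_le hf
  set R := EisensteinSeries.r ⟨⟨1, 1 / 2⟩, by simp⟩ ^ (-(2 - k)) with hR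
  refine ⟨M * Real.exp (4 * π * |lam|) * R, fun g z hz => ?_⟩
  have h0 : 0 < ‖autFactor g z‖ := norm_pos_iff.2 (autFactor_ne_zero _ _)
  rw [SL_slash_apply, norm_mul, twist, norm_mul, ← autFactor_eq_denom, norm_zpow, norm_exp]
  have h1 : (-(2 * π * I * lam * ((g • z : ℍ) : ℂ))).re ≤ 4 * π * |lam| := by
    have : -(2 * π * I * lam * ((g • z : ℍ) : ℂ)) =
        ((2 * π * lam : ℝ) : ℂ) * (-(I * ((g • z : ℍ) : ℂ))) := by push_cast; ring
    rw [this, re_ofReal_mul, neg_re, I_mul_re, neg_neg, coe_im]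
    have h2 := im_smul_le (g := g) hz
    have h3 := (g • z).im_pos
    calc 2 * π * lam * (g • z).im ≤ 2 * π * |lam| * 2 := by
          gcongr
          exact le_abs_self _
      _ = 4 * π * |lam| := by ring
  have h2 : ‖autFactor g z‖ ^ (-(2 : ℤ)) = ‖autFactor g z‖ ^ (-2 : ℝ) := by
    rw [← Real.rpow_intCast]; norm_num
  have h3 : ‖autFactor g z‖ ^ (-(2 - k)) ≤ R * ‖![g 1 0, g 1 1]‖ ^ (-(2 - k)) :=
    EisensteinSeries.summand_bound_of_mem_verticalStrip (by linarith) ![g 1 0, g 1 1] (by simp)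
      (mem_verticalStrip_of_mem_hypDisc hz)
  calc ‖f (g • z)‖ * Real.exp (-(2 * π * I * lam * ((g • z : ℍ) : ℂ))).re * ‖autFactor g z‖ ^ (-(2 : ℤ))
      ≤ (M * ‖autFactor g z‖ ^ k) * Real.exp (4 * π * |lam|) * ‖autFactor g z‖ ^ (-2 : ℝ) := by
        rw [h2]
        gcongr
        exact hM g z hz
    _ = M * Real.exp (4 * π * |lam|) * ‖autFactor g z‖ ^ (-(2 - k)) := by
        rw [show -(2 - k) = k + (-2) by ring, Real.rpow_add h0]
        ring
    _ ≤ M * Real.exp (4 * π * |lam|) * (R * ‖![g 1 0, g 1 1]‖ ^ (-(2 - k))) := by gcongr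
    _ = _ := by ring

/-! ### Summability over the coset representatives -/

/-- The bottom row determines `d` modulo `c`, and `a d ≡ 1` then determines `a` modulo `c`. So the
cusps differ by an integer, which is `0` when their floors agree. -/
theorem MapsInftyTo.eq_of_row_eq {γ γ' : SL(2, ℤ)} {x y : ℚ} (hx : MapsInftyTo γ x)
    (hy : MapsInftyTo γ' y) (hx0 : 0 ≤ x) (hy0 : 0 ≤ y) (hfl : ⌊x⌋₊ = ⌊y⌋₊)
    (hc : γ 1 0 = γ' 1 0) {m m' : ℤ} (hd : γ 1 0 * m + γ 1 1 = γ' 1 0 * m' + γ' 1 1) : x = y := by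
  obtain ⟨t, ht⟩ : γ' 1 0 ∣ γ 0 0 - γ' 0 0 := by
    refine ⟨γ 0 0 * γ' 0 0 * (m - m') + γ' 0 0 * γ 0 1 - γ 0 0 * γ' 0 1, ?_⟩
    have dx := det_eq_one γ
    have dy := det_eq_one γ'
    rw [hc] at dx hd
    linear_combination -(γ 0 0 * γ' 0 0) * hd + γ' 0 0 * dx - γ 0 0 * dy
  have h5 : x = y + t := by
    have hy0' : ((γ' 1 0 : ℤ) : ℚ) ≠ 0 := by exact_mod_cast hy.1.ne'
    rw [hx.2, hy.2, hc, eq_add_of_sub_eq ht]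
    push_cast
    field_simp
    ring
  have a1 := Nat.floor_le hx0
  have a2 := Nat.lt_floor_add_one x
  have a3 := Nat.floor_le hy0
  have a4 := Nat.lt_floor_add_one y
  rw [hfl] at a1 a2
  have a5 : (t : ℚ) < 1 := by linarith
  have a6 : (-1 : ℚ) < t := by linarith
  have a5' : t < 1 := by exact_mod_cast a5
  have a6' : -1 < t := by exact_mod_cast a6
  have ht0 : t = 0 := by omega
  simpa [ht0] using h5

/-- A bottom row fixes a matrix up to a power of `T` on the left; the extra index `j` or `⌊x⌋₊`
tells the `h` translates apart. -/
theorem cosetRep_injective_row {h : ℕ} {γ : ℚ → SL(2, ℤ)} (hγ : ∀ x, MapsInftyTo (γ x) x) :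
    Function.Injective fun i => ((cosetRep h γ i 1 0, cosetRep h γ i 1 1),
      Sum.elim (fun j : Fin h => (j : ℕ)) (fun p => ⌊p.1.1⌋₊) i) := by
  have hinl : ∀ j, cosetRep h γ (.inl j) 1 0 = 0 := fun j => by
    simp only [cosetRep, ModularGroup.coe_T_zpow]
    simp
  have hinr : ∀ x m, cosetRep h γ (.inr (x, m)) 1 0 = γ x 1 0 ∧
      cosetRep h γ (.inr (x, m)) 1 1 = γ x 1 0 * m + γ x 1 1 := fun x m =>
    ⟨(mul_T_zpow_apply (γ x) m).2.2.1, (mul_T_zpow_apply (γ x) m).2.2.2⟩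
  intro i j hij
  simp only [Prod.mk.injEq] at hij
  obtain ⟨⟨h3, h4⟩, h2⟩ := hij
  rcases i with i | ⟨x, m⟩ <;> rcases j with j | ⟨y, m'⟩
  · exact congrArg Sum.inl (Fin.ext h2)
  · have := (hγ y).1
    rw [hinl, (hinr y m').1] at h3
    omega
  · have := (hγ x).1
    rw [hinl, (hinr x m).1] at h3
    omega
  · rw [(hinr x m).1, (hinr y m').1] at h3
    rw [(hinr x m).2, (hinr y m').2] at h4
    have hxy : x = y :=
      Subtype.ext ((hγ x).eq_of_row_eq (hγ y) x.2.1 y.2.1 h2 h3 h4)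
    subst hxy
    rw [mul_left_cancel₀ (hγ x).1.ne' (add_right_cancel h4)]

/-- The row and the extra index embed the representatives into `h` copies of `ℤ ^ 2`, where the sum
is that of an Eisenstein series. -/
theorem summable_cosetRep {h : ℕ} {γ : ℚ → SL(2, ℤ)} (hγ : ∀ x, MapsInftyTo (γ x) x) {s : ℝ}
    (hs : 2 < s) : Summable fun i => ‖![cosetRep h γ i 1 0, cosetRep h γ i 1 1]‖ ^ (-s) := by
  have hlt : ∀ i : Fin h ⊕ ({x : ℚ // 0 ≤ x ∧ x < h} × ℤ),
      Sum.elim (fun j : Fin h => (j : ℕ)) (fun p => ⌊p.1.1⌋₊) i < h := by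
    rintro (j | p)
    · exact j.2
    · exact (Nat.floor_lt p.1.2.1).2 p.1.2.2
  have hsum : Summable fun p : (Fin 2 → ℤ) × Fin h => ‖p.1‖ ^ (-s) * (1 : ℝ) :=
    (EisensteinSeries.summable_one_div_norm_rpow hs).mul_of_nonneg
      (g := fun _ : Fin h => (1 : ℝ)) (Summable.of_finite) (fun _ => by positivity) (fun _ => by simp)
  simp only [mul_one] at hsum
  refine hsum.comp_injective (i := fun i =>
    (![cosetRep h γ i 1 0, cosetRep h γ i 1 1], (⟨_, hlt i⟩ : Fin h))) fun i j hij => ?_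
  refine cosetRep_injective_row hγ ?_
  simp only [Prod.mk.injEq, Fin.mk.injEq] at hij
  obtain ⟨h1, h2⟩ := hij
  have h3 := congrFun h1 0
  have h4 := congrFun h1 1
  simp only [Matrix.cons_val_zero, Matrix.cons_val_one] at h3 h4
  simp only [h3, h4, h2]

end ModularExpansion

namespace ModularExpansion

open Complex MeasureTheory ModularForm
open UpperHalfPlane hiding I

/-! ## Expansions with respect to different periods -/

theorem exp_two_pi_vadd (lam h : ℝ) (z : ℍ) :
    cexp (2 * π * I * lam * ((h +ᵥ z : ℍ) : ℂ)) =
      cexp (2 * π * I * lam * h) * cexp (2 * π * I * lam * z) := by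
  rw [coe_vadd, ← Complex.exp_add]
  ring_nf

theorem IsExpansion.hasSum {g : ℍ → ℂ} {h : ℝ} {a : ℝ → ℂ} (ha : IsExpansion g h a) (z : ℍ) :
    HasSum (fun lam : ℝ => a lam * cexp (2 * π * I * lam * z)) (g z) := by
  refine (hasSum_subtype_iff_of_support_subset (s := exponents g h) fun lam hlam => ?_).1 (ha.2 z)
  by_contra hn
  exact hlam (by simp [ha.1 lam hn])

/-- The coefficients of the expansion do not depend on the period. -/
theorem IsExpansion.of_period {g : ℍ → ℂ} (hg0 : g ≠ 0) {h h' : ℝ} (hh : 0 < h)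
    (hne : (exponents g h).Nonempty) {a : ℝ → ℂ} (ha : IsExpansion g h a) {u : ℂ} (hu : u ≠ 0)
    (hgu : ∀ z : ℍ, g (h' +ᵥ z) = u * g z) : IsExpansion g h' a := by
  -- Translating by `h'` and dividing by `u` gives a second expansion of `g`. Uniqueness forces `exp
  -- (2πi lam h') = u` wherever the coefficient is nonzero.
  have hb : IsExpansion g h fun lam => u⁻¹ * cexp (2 * π * I * lam * h') * a lam := by
    refine ⟨fun lam hlam => by simp only [ha.1 lam hlam, mul_zero], fun z => ?_⟩
    have h1 := (ha.2 (h' +ᵥ z)).mul_left u⁻¹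
    rw [hgu, inv_mul_cancel_left₀ hu] at h1
    convert! h1 using 2 with lam
    rw [exp_two_pi_vadd]
    ring
  have hab := ha.unique hg0 hh hne hb
  have hmem : ∀ lam, a lam ≠ 0 → lam ∈ exponents g h' := fun lam hlam z => by
    have h1 : a lam = u⁻¹ * cexp (2 * π * I * lam * h') * a lam := congrFun hab lam
    have h2 : u⁻¹ * cexp (2 * π * I * lam * h') = 1 := by
      apply mul_right_cancel₀ hlam
      rw [one_mul, ← h1]
    rw [hgu, eq_comm, ← inv_mul_eq_one₀ hu |>.1 h2]
  refine ⟨fun lam hlam => by_contra fun hn => hlam (hmem lam hn), fun z => ?_⟩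
  exact (hasSum_subtype_iff_of_support_subset (s := exponents g h') fun lam hlam =>
    hmem lam fun h0 => hlam (by simp [h0])).2 (ha.hasSum z)

theorem exponents_const_mul {g : ℍ → ℂ} {C : ℂ} (hC : C ≠ 0) (h : ℝ) :
    exponents (fun z => C * g z) h = exponents g h := by
  ext lam
  refine forall_congr' fun z => ?_
  rw [mul_left_comm, mul_right_inj' hC]

theorem IsExpansion.const_mul {g : ℍ → ℂ} {h : ℝ} {a : ℝ → ℂ} (ha : IsExpansion g h a) {C : ℂ}
    (hC : C ≠ 0) : IsExpansion (fun z => C * g z) h fun lam => C * a lam := by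
  rw [IsExpansion, exponents_const_mul hC]
  refine ⟨fun lam hlam => by simp only [ha.1 lam hlam, mul_zero], fun z => ?_⟩
  simpa only [mul_assoc] using (ha.2 z).mul_left C

theorem countable_exponents {g : ℍ → ℂ} (hg0 : g ≠ 0) {h : ℝ} (hh : 0 < h) :
    Countable (exponents g h) := by
  by_cases hne : (exponents g h).Nonempty
  · obtain ⟨l, hl⟩ := hne
    obtain ⟨e, -⟩ := exists_equiv hg0 hh hl
    exact e.symm.injective.countable
  · rw [Set.not_nonempty_iff_eq_empty.1 hne]
    infer_instance

theorem norm_exp_two_pi_mul_I_mul (lam h : ℝ) : ‖cexp (2 * π * I * lam * h)‖ = 1 := by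
  have : (2 * π * I * lam * h : ℂ) = ((2 * π * lam * h : ℝ) : ℂ) * I := by push_cast; ring
  rw [this, norm_exp_ofReal_mul_I]

/-! ## The functions `f_γ` -/

/-- Two holomorphic functions of the same absolute value differ by a constant factor. -/
theorem exists_eq_const_mul_of_norm_eq {U : Set ℂ} (hU : IsOpen U) (hUc : IsPreconnected U)
    {F G : ℂ → ℂ} (hF : DifferentiableOn ℂ F U) (hG : DifferentiableOn ℂ G U)
    (hFG : ∀ z ∈ U, ‖G z‖ = ‖F z‖) : ∃ u : ℂ, ‖u‖ = 1 ∧ ∀ z ∈ U, G z = u * F z := by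
  by_cases h0 : ∀ z ∈ U, F z = 0
  · refine ⟨1, norm_one, fun z hz => ?_⟩
    rw [h0 z hz, mul_zero, ← norm_eq_zero, hFG z hz, h0 z hz, norm_zero]
  push Not at h0
  obtain ⟨z₀, hz₀, hF0⟩ := h0
  have hev : ∀ᶠ z in nhds z₀, z ∈ U ∧ F z ≠ 0 :=
    (hU.eventually_mem hz₀).and ((hF.continuousOn.continuousAt (hU.mem_nhds hz₀)).eventually_ne hF0)
  obtain ⟨ε, hε, hball⟩ := Metric.eventually_nhds_iff_ball.1 hev
  have hnorm : ∀ z ∈ Metric.ball z₀ ε, ‖G z / F z‖ = 1 := fun z hz => by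
    rw [norm_div, hFG z (hball z hz).1, div_self (norm_ne_zero_iff.2 (hball z hz).2)]
  have hz₀' := Metric.mem_ball_self (x := z₀) hε
  -- The quotient has modulus `1` near `z₀`, so it is constant there by the maximum principle; the
  -- identity theorem extends this to `U`.
  have hconst := Complex.eqOn_of_isPreconnected_of_isMaxOn_norm (f := fun z => G z / F z)
    (convex_ball z₀ ε).isPreconnected Metric.isOpen_ball
    ((hG.mono fun z hz => (hball z hz).1).div (hF.mono fun z hz => (hball z hz).1)
      fun z hz => (hball z hz).2) hz₀' (fun z hz => by
        simp only [Function.comp_apply, Set.mem_ofPred_eq]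
        rw [hnorm z hz, hnorm z₀ hz₀'])
  refine ⟨G z₀ / F z₀, hnorm _ hz₀', ?_⟩
  refine (hG.analyticOnNhd hU).eqOn_of_preconnected_of_eventuallyEq
    ((hF.const_mul _).analyticOnNhd hU) hUc hz₀ ?_
  filter_upwards [Metric.ball_mem_nhds z₀ hε] with z hz
  have h1 : G z / F z = G z₀ / F z₀ := hconst hz
  rw [← h1, div_mul_cancel₀ _ (hball z hz).2]

theorem exists_vadd_eq_const_mul {g : ℍ → ℂ} (hg : MDifferentiable 𝓘(ℂ) 𝓘(ℂ) g) {h : ℝ}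
    (hh : ∀ z : ℍ, ‖g (h +ᵥ z)‖ = ‖g z‖) : ∃ u : ℂ, ‖u‖ = 1 ∧ ∀ z : ℍ, g (h +ᵥ z) = u * g z := by
  have hd := UpperHalfPlane.mdifferentiable_iff.1 hg
  have hadd : ∀ z : ℂ, 0 < z.im → ofComplex (z + h) = h +ᵥ ofComplex z := fun z hz => by
    have hz' : 0 < (z + h).im := by simpa using hz
    rw [ofComplex_apply_of_im_pos hz', ofComplex_apply_of_im_pos hz]
    ext
    simp [add_comm]
  obtain ⟨u, hu, huz⟩ := exists_eq_const_mul_of_norm_eq isOpen_upperHalfPlaneSet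
    (convex_halfSpace_im_gt 0).isPreconnected hd (G := fun z => (g ∘ ofComplex) (z + h))
    (hd.comp (by fun_prop) fun z hz => by simpa using hz) fun z hz => by
      simp only [Function.comp_apply]
      rw [hadd z hz, hh]
  refine ⟨u, hu, fun z => ?_⟩
  have := huz z z.im_pos
  simp only [Function.comp_apply] at this
  rwa [hadd _ z.im_pos, ofComplex_apply] at this

theorem autFactor_im_pos {γ : SL(2, ℤ)} (hγ : 0 < γ 1 0) (z : ℍ) : 0 < (autFactor γ z).im := by
  have h1 : (autFactor γ z).im = γ 1 0 * z.im := by simp [autFactor]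
  have h2 : (0 : ℝ) < γ 1 0 := by exact_mod_cast hγ
  have := z.im_pos
  rw [h1]
  positivity

/-- In the upper half plane `arg w - π / 2` stays in the principal range, so no jump occurs. Hence
`f_γ` is a constant multiple of the function whose order at infinity is assumed finite. -/
theorem div_I_cpow {w : ℂ} (hw : 0 < w.im) (s : ℂ) :
    (w / I) ^ s = cexp (-(π / 2 * I) * s) * w ^ s := by
  have hw0 : w ≠ 0 := fun h => by simp [h] at hw
  have h1 : w / I = cexp (log w - π / 2 * I) := by
    rw [Complex.exp_sub, exp_log hw0, exp_pi_div_two_mul_I]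
  have h2 : log (w / I) = log w - π / 2 * I := by
    have him : (log w - π / 2 * I).im = arg w - π / 2 := by
      have : (π / 2 * I : ℂ) = ((π / 2 : ℝ) : ℂ) * I := by push_cast; rfl
      rw [sub_im, this, im_ofReal_mul, Complex.I_im, mul_one, log_im]
    have h3 : 0 ≤ arg w := arg_nonneg_iff.2 hw.le
    have h4 := arg_le_pi w
    have h5 := Real.pi_pos
    rw [h1, log_exp] <;> rw [him] <;> linarith
  rw [cpow_def_of_ne_zero (div_ne_zero hw0 I_ne_zero), h2, cpow_def_of_ne_zero hw0,
    ← Complex.exp_add]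
  ring_nf

theorem div_I_mem_slitPlane {w : ℂ} (hw : 0 < w.im) : w / I ∈ slitPlane := by
  left
  rw [div_I]
  simpa using hw

theorem transform_eq {k : ℝ} {f : ℍ → ℂ} {γ : SL(2, ℤ)} (z : ℍ) :
    transform k f γ z = (autFactor γ z / I) ^ (-(k : ℂ)) * f (γ • z) := rfl

theorem norm_transform (k : ℝ) (f : ℍ → ℂ) (γ : SL(2, ℤ)) (z : ℍ) :
    ‖transform k f γ z‖ = ‖autFactor γ z‖ ^ (-k) * ‖f (γ • z)‖ := by
  have h0 : autFactor γ z / I ≠ 0 := div_ne_zero (autFactor_ne_zero γ z) I_ne_zero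
  rw [transform_eq, norm_mul, ← ofReal_neg, norm_cpow_of_ne_zero h0]
  simp

theorem mdifferentiable_transform {k : ℝ} {f : ℍ → ℂ} (hf : MDifferentiable 𝓘(ℂ) 𝓘(ℂ) f)
    {γ : SL(2, ℤ)} (hγ : 0 < γ 1 0) : MDifferentiable 𝓘(ℂ) 𝓘(ℂ) (transform k f γ) := by
  have h1 : MDifferentiable 𝓘(ℂ) 𝓘(ℂ) fun z : ℍ => f (γ • z) :=
    hf.comp (mdifferentiable_smul (g := (γ : GL (Fin 2) ℝ)) (by simp))
  rw [UpperHalfPlane.mdifferentiable_iff] at h1 ⊢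
  have h2 : DifferentiableOn ℂ (fun w : ℂ =>
      ((((γ 1 0 : ℤ) : ℂ) * w + ((γ 1 1 : ℤ) : ℂ)) / I) ^ (-(k : ℂ))) {z | 0 < z.im} := fun w hw => by
    refine DifferentiableAt.differentiableWithinAt ?_
    refine DifferentiableAt.cpow_const (by fun_prop) (div_I_mem_slitPlane ?_)
    exact autFactor_im_pos hγ ⟨w, hw⟩
  refine (h2.mul h1).congr fun w hw => ?_
  simp only [Function.comp_apply, transform, Pi.mul_apply]
  rw [ofComplex_apply_of_im_pos hw]

theorem transform_ne_zero {k : ℝ} {f : ℍ → ℂ} (hf0 : f ≠ 0) (γ : SL(2, ℤ)) :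
    transform k f γ ≠ 0 := by
  obtain ⟨z, hz⟩ := Function.ne_iff.1 hf0
  refine Function.ne_iff.2 ⟨γ⁻¹ • z, ?_⟩
  rw [transform_eq, smul_inv_smul]
  refine mul_ne_zero (fun h => ?_) hz
  exact div_ne_zero (autFactor_ne_zero γ _) I_ne_zero ((cpow_eq_zero_iff _ _).1 h).1

/-- Finite index puts some `γ T ^ n γ⁻¹` with `n > 0` into `Γ`; its factor of automorphy at `γ z`
cancels against the cocycle relation for `cz + d`. -/
theorem exists_norm_transform_vadd {Γ : Subgroup SL(2, ℤ)} [Γ.FiniteIndex] {k : ℝ} {f : ℍ → ℂ}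
    (hf : IsHolomorphicModularFunction Γ k f) (γ : SL(2, ℤ)) :
    ∃ n : ℕ, 0 < n ∧ ∀ z : ℍ, ‖transform k f γ ((n : ℝ) +ᵥ z)‖ = ‖transform k f γ z‖ := by
  obtain ⟨n, hn, -, hmem⟩ := Subgroup.exists_pow_mem_of_index_ne_zero
    (Subgroup.FiniteIndex.index_ne_zero (H := Γ)) (γ * ModularGroup.T * γ⁻¹)
  rw [conj_pow] at hmem
  refine ⟨n, hn, fun z => ?_⟩
  obtain ⟨j, -, hj, hfj⟩ := hf.automorphy _ hmem
  set δ := γ * ModularGroup.T ^ n * γ⁻¹ with hδ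
  have h1 : (n : ℝ) +ᵥ z = ModularGroup.T ^ (n : ℤ) • z := by
    rw [modular_T_zpow_smul]; simp
  have h2 : γ * ModularGroup.T ^ (n : ℤ) = δ * γ := by rw [hδ, zpow_natCast]; group
  have h3 : autFactor γ (ModularGroup.T ^ (n : ℤ) • z) = autFactor δ (γ • z) * autFactor γ z := by
    have h4 : autFactor (ModularGroup.T ^ (n : ℤ)) z = 1 := by
      rw [autFactor, ModularGroup.coe_T_zpow]; simp
    rw [← autFactor_mul, ← h2, autFactor_mul, h4, mul_one]
  have h5 : ‖j (γ • z)‖ = ‖autFactor δ (γ • z)‖ ^ k := hj _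
  have h6 : 0 < ‖autFactor δ (γ • z)‖ := norm_pos_iff.2 (autFactor_ne_zero _ _)
  rw [norm_transform, norm_transform, h1, h3, ← mul_smul, h2, mul_smul, hfj, norm_mul, norm_mul, h5,
    Real.mul_rpow (norm_nonneg _) (norm_nonneg _), Real.rpow_neg h6.le]
  have : ‖autFactor δ (γ • z)‖ ^ k ≠ 0 := (Real.rpow_pos_of_pos h6 _).ne'
  field_simp

theorem vadd_nsmul_eq_pow_mul {g : ℍ → ℂ} {h : ℝ} {u : ℂ} (hgu : ∀ z : ℍ, g (h +ᵥ z) = u * g z)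
    (n : ℕ) (z : ℍ) : g ((n * h : ℝ) +ᵥ z) = u ^ n * g z := by
  induction n with
  | zero => simp
  | succ n ih =>
    rw [pow_succ', mul_assoc, ← ih, ← hgu, vadd_vadd]
    push_cast
    ring_nf

/-- The definition of `quasiPeriod` does not ask for a multiplier of modulus `1`. Translating by `n
* p` in two ways, with `p` the quasi-period, gives `v ^ n = u ^ p`, hence `‖v‖ = 1`. -/
theorem quasiPeriod_spec {g : ℍ → ℂ} (hg0 : g ≠ 0) {n : ℕ} (hn : 0 < n) {u : ℂ} (hu : ‖u‖ = 1)
    (hgu : ∀ z : ℍ, g ((n : ℝ) +ᵥ z) = u * g z) :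
    0 < quasiPeriod g ∧ ∃ v : ℂ, ‖v‖ = 1 ∧ ∀ z : ℍ, g ((quasiPeriod g : ℝ) +ᵥ z) = v * g z := by
  obtain ⟨hp, v, hv⟩ := Nat.sInf_mem
    (s := {n : ℕ | 0 < n ∧ ∃ u : ℂ, ∀ z : ℍ, g ((n : ℝ) +ᵥ z) = u * g z}) ⟨n, hn, u, hgu⟩
  refine ⟨hp, v, ?_, hv⟩
  obtain ⟨z, hz⟩ := Function.ne_iff.1 hg0
  have h1 := vadd_nsmul_eq_pow_mul hv n z
  have h2 := vadd_nsmul_eq_pow_mul hgu (quasiPeriod g) z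
  rw [mul_comm] at h2
  have h3 := mul_right_cancel₀ hz (h1.symm.trans h2)
  have h4 := congrArg norm h3
  rw [norm_pow, norm_pow, hu, one_pow] at h4
  exact (pow_eq_one_iff_of_nonneg (norm_nonneg _) hn.ne').1 h4

theorem quasiPeriod_transform {Γ : Subgroup SL(2, ℤ)} [Γ.FiniteIndex] {k : ℝ} {f : ℍ → ℂ}
    (hf : IsHolomorphicModularFunction Γ k f) (hf0 : f ≠ 0) {γ : SL(2, ℤ)} (hγ : 0 < γ 1 0) :
    0 < quasiPeriod (transform k f γ) ∧ ∃ v : ℂ, ‖v‖ = 1 ∧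
      ∀ z : ℍ, transform k f γ ((quasiPeriod (transform k f γ) : ℝ) +ᵥ z) =
        v * transform k f γ z := by
  obtain ⟨n, hn, hnorm⟩ := exists_norm_transform_vadd hf γ
  obtain ⟨u, hu, hgu⟩ := exists_vadd_eq_const_mul (mdifferentiable_transform (k := k) hf.holo hγ) hnorm
  exact quasiPeriod_spec (transform_ne_zero hf0 γ) hn hu hgu

theorem isExpansion_cuspCoeff {Γ : Subgroup SL(2, ℤ)} [Γ.FiniteIndex] {k : ℝ} {f : ℍ → ℂ}
    (hf : IsHolomorphicModularFunction Γ k f) (hf0 : f ≠ 0) {γ : SL(2, ℤ)} (hγ : 0 < γ 1 0) :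
    IsExpansion (transform k f γ) (quasiPeriod (transform k f γ)) (cuspCoeff k f γ) := by
  obtain ⟨hp, v, hv, hgv⟩ := quasiPeriod_transform hf hf0 hγ
  exact isExpansion_coeff (mdifferentiable_transform hf.holo hγ) (transform_ne_zero hf0 γ)
    (by exact_mod_cast hp) hv hgv

/-- The principal part of `f_γ` at infinity is finite. -/
theorem finite_cuspCoeff_neg {Γ : Subgroup SL(2, ℤ)} [Γ.FiniteIndex] {k : ℝ} {f : ℍ → ℂ}
    (hf : IsHolomorphicModularFunction Γ k f) (hf0 : f ≠ 0) {γ : SL(2, ℤ)} (hγ : 0 < γ 1 0) :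
    {mu : ℝ | mu < 0 ∧ cuspCoeff k f γ mu ≠ 0}.Finite := by
  obtain ⟨h, hh, ⟨u, hu, hgu⟩, hfin⟩ := hf.finiteOrder γ
  set g : ℍ → ℂ := fun z : ℍ =>
    (((γ 1 0 : ℤ) : ℂ) * z + ((γ 1 1 : ℤ) : ℂ)) ^ (-(k : ℂ)) * f (γ • z) with hg
  set C : ℂ := cexp (-(π / 2 * I) * (-(k : ℂ))) with hC
  have hC0 : C ≠ 0 := Complex.exp_ne_zero _
  have htr : transform k f γ = fun z => C * g z := by
    funext z
    rw [transform_eq, div_I_cpow (autFactor_im_pos hγ z), mul_assoc]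
    rfl
  have hgtr : g = fun z => C⁻¹ * transform k f γ z := by
    funext z
    rw [htr, inv_mul_cancel_left₀ hC0]
  have hgd : MDifferentiable 𝓘(ℂ) 𝓘(ℂ) g := by
    rw [hgtr]
    exact mdifferentiable_const.mul (mdifferentiable_transform hf.holo hγ)
  have hg0 : g ≠ 0 := fun h0 => transform_ne_zero (k := k) hf0 γ (by
    rw [htr, h0]; funext z; simp)
  -- The finiteness assumption concerns another branch of the power and an unspecified period `h`.
  -- The constant `C` absorbs the former and `IsExpansion.of_period` the latter.
  have h1 := (isExpansion_coeff hgd hg0 hh hu hgu).const_mul hC0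
  rw [← htr] at h1
  obtain ⟨hp, v, hv, hgv⟩ := quasiPeriod_transform hf hf0 hγ
  have hexp : (exponents (transform k f γ) h).Nonempty := by
    rw [htr, exponents_const_mul hC0]
    exact exponents_nonempty hh hu hgu
  have h2 := h1.of_period (transform_ne_zero hf0 γ) hh hexp (fun h => by simp [h] at hv) hgv
  have h3 := h2.eq_coeff (transform_ne_zero hf0 γ) (by exact_mod_cast hp) hv hgv
  refine hfin.subset fun mu hmu => ⟨hmu.1, fun h0 => hmu.2 ?_⟩
  simp only [cuspCoeff, ← h3, h0, mul_zero]

end ModularExpansion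

namespace ModularExpansion

open Complex MeasureTheory ModularForm
open UpperHalfPlane hiding I

/-! ## The contribution of a cusp -/

/-- In the coordinate `s`, `cz + d = i c s` and `γ z = a / c + i / (c ^ 2 s)`. So `lam` contributes
`exp (2π lam / (c ^ 2 s))`, and `(i c s) ^ (-2)`, the source of the minus sign, supplies the power
of `s` left over by `f_γ`. -/
theorem slash_twist_eq (k : ℝ) (f : ℍ → ℂ) (lam : ℝ) {γ : SL(2, ℤ)} {c : ℕ} (hc : γ 1 0 = c)
    (hc0 : 0 < c) {s : ℂ} (hs : s ≠ 0) {z : ℍ} (hz : (z : ℂ) = I * s - (γ 1 1 : ℤ) / c) :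
    (twist f lam ∣[(2 : ℤ)] γ) z =
      -(((c : ℝ) ^ (-(2 - k)) : ℝ) : ℂ) * cexp (-(2 * π * I * (lam * (γ 0 0 : ℤ) / c))) *
        (s ^ (-((2 - k : ℝ) : ℂ)) * cexp ((2 * π * lam / c ^ 2 : ℝ) / s)) * transform k f γ z := by
  have hcC : (c : ℂ) ≠ 0 := by exact_mod_cast hc0.ne'
  have hcR : (0 : ℝ) < c := by exact_mod_cast hc0
  have hcC' : ((c : ℝ) : ℂ) ≠ 0 := ofReal_ne_zero.2 hcR.ne'
  have hj : autFactor γ z = c * I * s := by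
    rw [autFactor, hc, hz]
    push_cast
    field_simp
    ring
  have hdet : ((γ 0 0 : ℤ) : ℂ) * (γ 1 1 : ℤ) - (γ 0 1 : ℤ) * c = 1 := by
    have := det_eq_one γ
    rw [hc] at this
    exact_mod_cast this
  have hsm : ((γ • z : ℍ) : ℂ) = (γ 0 0 : ℤ) / c + I / (c ^ 2 * s) := by
    rw [coe_smul_eq_div, hj, hz]
    field_simp
    linear_combination (-1 : ℂ) * hdet - I_sq
  have hexp : cexp (-(2 * π * I * lam * ((γ • z : ℍ) : ℂ))) =
      cexp (-(2 * π * I * (lam * (γ 0 0 : ℤ) / c))) * cexp ((2 * π * lam / c ^ 2 : ℝ) / s) := by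
    rw [← Complex.exp_add, hsm]
    congr 1
    push_cast
    field_simp
    linear_combination (-lam : ℂ) * I_sq
  have h1 : c * I * s / I = ((c : ℝ) : ℂ) * s := by
    push_cast
    field_simp
  have h2 : (c * I * s) ^ (-(2 : ℤ)) =
      -((((c : ℝ) ^ (-(2 - k)) : ℝ) : ℂ) * s ^ (-((2 - k : ℝ) : ℂ)) *
        (((c : ℝ) : ℂ) * s) ^ (-(k : ℂ))) := by
    rw [ofReal_mul_cpow hcR hs, ofReal_cpow hcR.le, mul_mul_mul_comm, ← cpow_add _ _ hcC',
      ← cpow_add _ _ hs]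
    have : ((-(2 - k) : ℝ) : ℂ) + -(k : ℂ) = ((-2 : ℤ) : ℂ) := by push_cast; ring
    rw [this]
    have : (-((2 - k : ℝ) : ℂ)) + -(k : ℂ) = ((-2 : ℤ) : ℂ) := by push_cast; ring
    rw [this, cpow_intCast, cpow_intCast, zpow_neg, zpow_neg, zpow_neg, ← mul_inv]
    have h3 : (c * I * s) ^ (2 : ℤ) = -(((c : ℝ) : ℂ) ^ (2 : ℤ) * s ^ (2 : ℤ)) := by
      simp only [zpow_ofNat]
      push_cast
      linear_combination (c : ℂ) ^ 2 * s ^ 2 * I_sq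
    rw [h3, inv_neg]
  rw [SL_slash_apply, twist, ← autFactor_eq_denom, transform_eq, hj, h1, h2, hexp]
  ring

/-- A `∑ᶠ` of infinite support is `0` by convention; the finite principal part is what makes it the
true sum. -/
theorem tsum_subtype_eq_finsum {G : ℝ → ℂ} {Λ : Set ℝ}
    (hfin : {mu : ℝ | mu < 0 ∧ G mu ≠ 0}.Finite) :
    ∑' mu : Λ, (if (mu : ℝ) < 0 then G mu else 0) = ∑ᶠ mu ∈ {mu : ℝ | mu ∈ Λ ∧ mu < 0}, G mu := by
  rw [tsum_subtype Λ fun mu : ℝ => if mu < 0 then G mu else 0, finsum_mem_def, tsum_eq_finsum]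
  · refine finsum_congr fun mu => ?_
    by_cases h1 : mu ∈ Λ <;> by_cases h2 : mu < 0 <;> simp [h1, h2]
  · refine hfin.subset fun mu hmu => ?_
    have h1 : mu ∈ Λ := Set.mem_of_indicator_ne_zero hmu
    rw [Function.mem_support, Set.indicator_of_mem h1] at hmu
    by_contra hn
    refine hmu (ite_eq_right_iff.2 fun h2 => ?_)
    by_contra h3
    exact hn ⟨h2, h3⟩

/-- The function that remains after splitting off `f_γ` from the integrand at a cusp. -/
noncomputable def cuspKernel (ν B Y : ℝ) (t : ℝ) : ℂ :=
  ((Y : ℂ) + t * I) ^ (-(ν : ℂ)) * cexp (B / (Y + t * I))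

theorem integrable_cuspKernel {ν : ℝ} (hν : 1 < ν) (B : ℝ) {Y : ℝ} (hY : 0 < Y) :
    Integrable (cuspKernel ν B Y) := by
  refine (integrable_cpow_add_mul_I hν hY).mul_bdd (c := Real.exp (|B| / Y)) ?_ ?_
  · exact (continuous_exp.comp
      (continuous_const.div (by fun_prop) fun t => add_mul_I_ne_zero hY t)).aestronglyMeasurable
  · refine Filter.Eventually.of_forall fun t => ?_
    rw [norm_exp]
    refine Real.exp_le_exp.2 ((re_le_norm _).trans ?_)
    rw [norm_div, norm_real, Real.norm_eq_abs]
    gcongr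
    exact le_norm_add_mul_I t

variable {Γ : Subgroup SL(2, ℤ)} [Γ.FiniteIndex] {k : ℝ} {f : ℍ → ℂ}

/-- Insert the expansion of `f_γ` and integrate termwise. On a horizontal line each term has
constant modulus `‖a mu‖ * exp (-2π mu Y)`, summable by convergence at one point, and the kernel is
integrable because `2 - k > 1`. Each integral is then the Laplace formula with `x = -mu` and `B = 2π
lam / c ^ 2`. -/
theorem integral_slash_twist (hk : k < 0) (hf : IsHolomorphicModularFunction Γ k f) (hf0 : f ≠ 0)
    (lam : ℝ) {γ : SL(2, ℤ)} {c : ℕ} (hc : γ 1 0 = c) (hc0 : 0 < c) {Y : ℝ} (hY : 0 < Y) :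
    Integrable (fun t : ℝ => (twist f lam ∣[(2 : ℤ)] γ) (ofComplex (t + Y * I))) ∧
    ∫ t : ℝ, (twist f lam ∣[(2 : ℤ)] γ) (ofComplex (t + Y * I)) =
      -(((2 * π) ^ (2 - k) : ℝ) : ℂ) * ((((c : ℝ) ^ (k - 2) : ℝ) : ℂ) *
        ∑ᶠ mu ∈ {mu : ℝ | mu ∈ cuspExponents k f γ ∧ mu < 0},
          beta k f γ lam mu * ((|mu| ^ (1 - k) : ℝ) : ℂ) *
            besselL (1 - k) (4 * π ^ 2 * lam * |mu| / (c : ℂ) ^ 2)) := by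
  have hγ : 0 < γ 1 0 := by rw [hc]; exact_mod_cast hc0
  have hcR : (0 : ℝ) < c := by exact_mod_cast hc0
  have hcC : (c : ℂ) ≠ 0 := by exact_mod_cast hc0.ne'
  set ν : ℝ := 2 - k with hν
  have hν1 : 1 < ν := by linarith
  set B : ℝ := 2 * π * lam / c ^ 2 with hB
  set d : ℝ := ((γ 1 1 : ℤ) : ℝ) / c with hd
  set D : ℂ := -(((c : ℝ) ^ (-ν) : ℝ) : ℂ) * cexp (-(2 * π * I * (lam * (γ 0 0 : ℤ) / c))) with hD
  set Ψ : ℝ → ℂ := fun t => (twist f lam ∣[(2 : ℤ)] γ) (ofComplex (t + Y * I)) with hΨ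
  -- The real part is `-d - t` so that `Z t = i (Y + i t) - d`, with `d` now denoting `γ 1 1 / c`.
  -- This reflection of the line leaves the integral unchanged.
  set Z : ℝ → ℍ := fun t => ofComplex (((-d - t : ℝ) : ℂ) + Y * I) with hZ
  have hZc : ∀ t, ((Z t : ℍ) : ℂ) = I * (Y + t * I) - (γ 1 1 : ℤ) / c := fun t => by
    have : 0 < (((-d - t : ℝ) : ℂ) + Y * I).im := by simpa using hY
    simp only [hZ]
    rw [ofComplex_apply_of_im_pos this, hd]
    push_cast
    linear_combination (-t : ℂ) * I_sq
  have hΦ : ∀ t, Ψ (-d - t) = D * cuspKernel ν B Y t * transform k f γ (Z t) := fun t =>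
    slash_twist_eq k f lam hc hc0 (add_mul_I_ne_zero hY t) (hZc t)
  set g := transform k f γ with hg
  have hg0 : g ≠ 0 := transform_ne_zero hf0 γ
  set a := cuspCoeff k f γ with ha
  set p : ℝ := ((quasiPeriod g : ℕ) : ℝ) with hp
  have hp0 : 0 < p := Nat.cast_pos.2 (quasiPeriod_transform hf hf0 hγ).1
  have hexp : IsExpansion g p a := isExpansion_cuspCoeff hf hf0 hγ
  have : Countable (exponents g p) := countable_exponents hg0 hp0
  have hnorm : ∀ (mu t : ℝ), ‖a mu * cexp (2 * π * I * mu * (Z t : ℂ))‖ =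
      ‖a mu‖ * Real.exp (-(2 * π * mu * Y)) := fun mu t => by
    rw [norm_mul, norm_exp]
    congr 2
    have : 2 * π * I * mu * (Z t : ℂ) = ((2 * π * mu : ℝ) : ℂ) * (I * (Z t : ℂ)) := by
      push_cast; ring
    have him : ((Z t : ℍ) : ℂ).im = Y := by
      simp only [hZ]
      rw [ofComplex_apply_of_im_pos (by simpa using hY)]
      simp
    rw [this, re_ofReal_mul, I_mul_re, him]
    ring
  have hsum : Summable fun mu : exponents g p => ‖a mu‖ * Real.exp (-(2 * π * mu * Y)) := by
    refine ((hexp.2 (Z 0)).summable.norm).congr fun mu => hnorm mu 0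
  have hgc : Continuous fun t => g (Z t) := by
    have h1 := UpperHalfPlane.mdifferentiable_iff.1 (mdifferentiable_transform (k := k) hf.holo hγ)
    exact h1.continuousOn.comp_continuous (by fun_prop) fun t => by simpa using hY
  have hgb : ∀ t, ‖g (Z t)‖ ≤ ∑' mu : exponents g p, ‖a mu‖ * Real.exp (-(2 * π * mu * Y)) :=
    fun t => by
      rw [← (hexp.2 (Z t)).tsum_eq]
      refine (norm_tsum_le_tsum_norm ?_).trans_eq (tsum_congr fun mu => hnorm mu t)
      exact hsum.congr fun mu => (hnorm mu t).symm
  have hK : Integrable fun t => D * cuspKernel ν B Y t := (integrable_cuspKernel hν1 B hY).const_mul D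
  have hΦi : Integrable fun t => Ψ (-d - t) := by
    simp_rw [hΦ]
    exact hK.mul_bdd hgc.aestronglyMeasurable (Filter.Eventually.of_forall hgb)
  refine ⟨?_, ?_⟩
  · have := hΦi.comp_sub_left (-d)
    simpa using this
  have hFi : ∀ mu : exponents g p, Integrable fun t : ℝ =>
      D * cuspKernel ν B Y t * (a mu * cexp (2 * π * I * (mu : ℝ) * (Z t : ℂ))) := fun mu => by
    refine hK.mul_bdd (c := ‖a mu‖ * Real.exp (-(2 * π * mu * Y))) ?_
      (Filter.Eventually.of_forall fun t => (hnorm mu t).le)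
    refine Continuous.aestronglyMeasurable ?_
    simp_rw [hZc]
    fun_prop
  have key := hasSum_integral_of_summable_integral_norm hFi (by
    have h1 : ∀ mu : exponents g p, ∫ t : ℝ, ‖D * cuspKernel ν B Y t *
        (a mu * cexp (2 * π * I * (mu : ℝ) * (Z t : ℂ)))‖ =
        (∫ t : ℝ, ‖D * cuspKernel ν B Y t‖) * (‖a mu‖ * Real.exp (-(2 * π * mu * Y))) := fun mu => by
      rw [← integral_mul_const]
      congr 1
      funext t
      rw [norm_mul, hnorm]
    simp_rw [h1]
    exact hsum.mul_left _)
  have htsum : ∀ t : ℝ, ∑' mu : exponents g p, D * cuspKernel ν B Y t *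
      (a mu * cexp (2 * π * I * (mu : ℝ) * (Z t : ℂ))) = Ψ (-d - t) := fun t => by
    rw [tsum_mul_left, (hexp.2 (Z t)).tsum_eq, hΦ]
  simp_rw [htsum] at key
  rw [integral_sub_left_eq_self (fun t => Ψ t) volume (-d)] at key
  rw [← key.tsum_eq, ← tsum_subtype_eq_finsum, ← tsum_mul_left, ← tsum_mul_left]
  · refine tsum_congr fun mu => ?_
    have h1 : ∀ t : ℝ, D * cuspKernel ν B Y t * (a mu * cexp (2 * π * I * (mu : ℝ) * (Z t : ℂ))) =
        D * a mu * cexp (-(2 * π * I * ((mu : ℝ) * (γ 1 1 : ℤ) / c))) *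
        (((Y : ℂ) + t * I) ^ (-(ν : ℂ)) * cexp (2 * π * (-(mu : ℝ) : ℝ) * (Y + t * I)) *
          cexp (B / (Y + t * I))) := fun t => by
      have h2 : cexp (2 * π * I * (mu : ℝ) * (Z t : ℂ)) =
          cexp (-(2 * π * I * ((mu : ℝ) * (γ 1 1 : ℤ) / c))) *
            cexp (2 * π * (-(mu : ℝ) : ℝ) * (Y + t * I)) := by
        rw [← Complex.exp_add, hZc]
        congr 1
        push_cast
        linear_combination (2 * π * (mu : ℝ) * (Y + t * I) : ℂ) * I_sq
      rw [h2, cuspKernel]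
      ring
    simp_rw [h1]
    rw [integral_const_mul, integral_cpow_mul_exp_mul_exp_div hν1 hY]
    split_ifs with hmu
    · have h3 : max (-(mu : ℝ)) 0 = |(mu : ℝ)| := by
        rw [max_eq_left (by linarith), abs_of_neg hmu]
      have h4 : ((ν : ℂ) - 1) = 1 - k := by rw [hν]; push_cast; ring
      have h5 : (2 * π * (-(mu : ℝ) : ℝ) * B : ℂ) = 4 * π ^ 2 * lam * |(mu : ℝ)| / (c : ℂ) ^ 2 := by
        rw [abs_of_neg hmu, hB]
        push_cast
        ring
      have h6 : beta k f γ lam mu = a mu * (cexp (-(2 * π * I * (lam * (γ 0 0 : ℤ) / c))) *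
          cexp (-(2 * π * I * ((mu : ℝ) * (γ 1 1 : ℤ) / c)))) := by
        rw [beta, ← Complex.exp_add, hc]
        congr 2
        push_cast
        ring
      rw [h3, h4, h5, h6, hD, show ν - 1 = 1 - k by rw [hν]; ring, show -ν = k - 2 by rw [hν]; ring]
      push_cast
      ring
    · rw [max_eq_right (by linarith), Real.zero_rpow (by linarith)]
      simp
  · refine (finite_cuspCoeff_neg hf hf0 hγ).subset fun mu hmu => ⟨hmu.1, fun h0 => hmu.2 ?_⟩
    rw [beta, h0, zero_mul, zero_mul, zero_mul]

end ModularExpansion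

namespace ModularExpansion

open Complex MeasureTheory ModularForm
open UpperHalfPlane hiding I

/-! ## The contribution of infinity -/

theorem slash_mul_T_zpow (φ : ℍ → ℂ) (g : SL(2, ℤ)) (m : ℤ) {Y : ℝ} (hY : 0 < Y) (t : ℝ) :
    (φ ∣[(2 : ℤ)] (g * ModularGroup.T ^ m)) (ofComplex (t + Y * I)) =
      (φ ∣[(2 : ℤ)] g) (ofComplex ((t + m : ℝ) + Y * I)) := by
  have h1 : 0 < ((t : ℂ) + Y * I).im := by simpa using hY
  have h2 : 0 < (((t + m : ℝ) : ℂ) + Y * I).im := by simpa using hY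
  have h3 : ModularGroup.T ^ m • ofComplex (t + Y * I) = ofComplex ((t + m : ℝ) + Y * I) := by
    rw [modular_T_zpow_smul, ofComplex_apply_of_im_pos h1, ofComplex_apply_of_im_pos h2]
    ext
    simp
    ring
  have h4 : autFactor (ModularGroup.T ^ m) (ofComplex (t + Y * I)) = 1 := by
    rw [autFactor, ModularGroup.coe_T_zpow]
    simp
  rw [SlashAction.slash_mul, SL_slash_apply (γ := ModularGroup.T ^ m), h3, ← autFactor_eq_denom, h4,
    one_zpow, mul_one]

theorem integral_exp_period {h : ℝ} (hh : 0 < h) {n : ℤ} (hn : n ≠ 0) (b : ℝ) :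
    ∫ t in b..(b + h), cexp (2 * π * I * (n / h) * t) = 0 := by
  have hh0 : (h : ℂ) ≠ 0 := ofReal_ne_zero.2 hh.ne'
  have hc : 2 * π * I * (n / h) ≠ 0 :=
    mul_ne_zero two_pi_I_ne_zero (div_ne_zero (Int.cast_ne_zero.2 hn) hh0)
  rw [integral_exp_mul_complex hc]
  have : cexp (2 * π * I * (n / h) * (b + h : ℝ)) = cexp (2 * π * I * (n / h) * b) := by
    rw [exp_eq_exp_iff_exists_int]
    refine ⟨n, ?_⟩
    push_cast
    field_simp
  rw [this, sub_self, zero_div]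

theorem mdifferentiable_twist {f : ℍ → ℂ} (hf : MDifferentiable 𝓘(ℂ) 𝓘(ℂ) f) (lam : ℝ) :
    MDifferentiable 𝓘(ℂ) 𝓘(ℂ) (twist f lam) := by
  rw [UpperHalfPlane.mdifferentiable_iff] at hf ⊢
  have h1 : DifferentiableOn ℂ (fun w : ℂ => cexp (-(2 * π * I * lam * w))) {z | 0 < z.im} := by
    fun_prop
  refine (hf.mul h1).congr fun w hw => ?_
  simp only [Function.comp_apply, twist, Pi.mul_apply]
  rw [ofComplex_apply_of_im_pos hw]

theorem twist_vadd {f : ℍ → ℂ} {h lam : ℝ} (hlam : lam ∈ exponents f h) (z : ℍ) :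
    twist f lam (h +ᵥ z) = twist f lam z := by
  simp only [twist]
  rw [hlam z, mul_right_comm, ← Complex.exp_add, mul_comm, coe_vadd]
  congr 2
  ring

/-- The coefficients of the expansion as integrals over a period. -/
theorem integral_twist {f : ℍ → ℂ} (hf0 : f ≠ 0) {h : ℝ} (hh : 0 < h) {a : ℝ → ℂ}
    (ha : IsExpansion f h a) {lam : ℝ} (hlam : lam ∈ exponents f h) {Y : ℝ} (hY : 0 < Y) (b : ℝ) :
    ∫ t in b..(b + h), twist f lam (ofComplex (t + Y * I)) = h * a lam := by
  obtain ⟨e, he⟩ := exists_equiv hf0 hh hlam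
  set z : ℝ → ℍ := fun t => ofComplex (t + Y * I) with hz
  have hzc : ∀ t, ((z t : ℍ) : ℂ) = t + Y * I := fun t => by
    simp only [hz]
    rw [ofComplex_apply_of_im_pos (by simpa using hY)]
  set C : ℤ → ℂ := fun n => a (e n) * cexp (2 * π * I * (n / h) * (Y * I)) with hC
  have hterm : ∀ (n : ℤ) (t : ℝ), a (e n) * cexp (2 * π * I * (e n : ℝ) * (z t : ℂ)) *
      cexp (-(2 * π * I * lam * (z t : ℂ))) = C n * cexp (2 * π * I * (n / h) * t) := fun n t => by
    simp only [hC]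
    rw [mul_assoc, mul_assoc (a (e n)), ← Complex.exp_add, ← Complex.exp_add, he, hzc]
    congr 2
    push_cast
    ring
  have hsum : ∀ t : ℝ, HasSum (fun n => C n * cexp (2 * π * I * (n / h) * t))
      (twist f lam (z t)) :=
    fun t => by
      have h1 := (ha.2 (z t)).mul_right (cexp (-(2 * π * I * lam * (z t : ℂ))))
      rw [← e.hasSum_iff] at h1
      convert! h1 using 2 with n
      exact (hterm n t).symm
  have hnorm : ∀ (n : ℤ) (t : ℝ), ‖C n * cexp (2 * π * I * (n / h) * t)‖ = ‖C n‖ := fun n t => by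
    have : (2 * π * I * (n / h) * t : ℂ) = ((2 * π * (n / h) * t : ℝ) : ℂ) * I := by push_cast; ring
    rw [norm_mul, this, norm_exp_ofReal_mul_I, mul_one]
  have hCs : Summable fun n => ‖C n‖ := ((hsum 0).summable.norm).congr fun n => hnorm n 0
  have key := intervalIntegral.hasSum_integral_of_dominated_convergence (μ := volume) (a := b)
    (b := b + h) (F := fun n (t : ℝ) => C n * cexp (2 * π * I * (n / h) * t))
    (f := fun t => twist f lam (z t)) (fun n _ => ‖C n‖)
    (fun n => Continuous.aestronglyMeasurable (by fun_prop))
    (fun n => Filter.Eventually.of_forall fun t _ => (hnorm n t).le)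
    (Filter.Eventually.of_forall fun t _ => hCs) intervalIntegrable_const
    (Filter.Eventually.of_forall fun t _ => hsum t)
  refine key.unique ?_
  have h0 : ((e 0 : exponents f h) : ℝ) = lam := by rw [he]; simp
  have hint : ∀ n, ∫ t in b..(b + h), C n * cexp (2 * π * I * (n / h) * t) =
      if n = 0 then h * a lam else 0 := fun n => by
    rw [intervalIntegral.integral_const_mul]
    split_ifs with hn
    · subst hn
      simp [hC, h0, mul_comm]
    · rw [integral_exp_period hh hn, mul_zero]
  simp_rw [hint]
  exact hasSum_ite_eq 0 _

/-- The `h` unit segments are adjacent and fill one period starting at `-1/2`. -/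
theorem sum_integral_slash_T_zpow {f : ℍ → ℂ} (hf : MDifferentiable 𝓘(ℂ) 𝓘(ℂ) f) (hf0 : f ≠ 0)
    {h : ℕ} (hh : 0 < h) {a : ℝ → ℂ} (ha : IsExpansion f h a) {lam : ℝ}
    (hlam : lam ∈ exponents f h) {Y : ℝ} (hY : 0 < Y) :
    ∑ j : Fin h, ∫ t in (-(1 / 2) : ℝ)..(1 / 2),
      (twist f lam ∣[(2 : ℤ)] (ModularGroup.T ^ ((j : ℕ) : ℤ))) (ofComplex (t + Y * I)) =
      h * a lam := by
  set ψ : ℝ → ℂ := fun t => twist f lam (ofComplex (t + Y * I)) with hψ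
  have hcont : Continuous ψ := by
    have h1 := UpperHalfPlane.mdifferentiable_iff.1 (mdifferentiable_twist hf lam)
    exact h1.continuousOn.comp_continuous (by fun_prop) fun t => by simpa using hY
  have h1 : ∀ j : ℕ, ∫ t in (-(1 / 2) : ℝ)..(1 / 2),
      (twist f lam ∣[(2 : ℤ)] (ModularGroup.T ^ (j : ℤ))) (ofComplex (t + Y * I)) =
      ∫ t in (-(1 / 2) + (j : ℝ))..(-(1 / 2) + ((j + 1 : ℕ) : ℝ)), ψ t := fun j => by
    have h2 : ∀ t : ℝ, (twist f lam ∣[(2 : ℤ)] (ModularGroup.T ^ (j : ℤ))) (ofComplex (t + Y * I)) =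
        ψ (t + j) := fun t => by
      have := slash_mul_T_zpow (twist f lam) 1 j hY t
      rw [one_mul, SlashAction.slash_one] at this
      exact this
    simp_rw [h2]
    rw [intervalIntegral.integral_comp_add_right]
    congr 1
    push_cast
    ring
  simp_rw [h1]
  rw [Fin.sum_univ_eq_sum_range fun j : ℕ =>
      ∫ t in (-(1 / 2) + (j : ℝ))..(-(1 / 2) + ((j + 1 : ℕ) : ℝ)), ψ t,
    intervalIntegral.sum_integral_adjacent_intervals fun j _ => hcont.intervalIntegrable _ _]
  rw [Nat.cast_zero, add_zero, integral_twist hf0 (by exact_mod_cast hh) ha hlam hY]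
  simp

/-- The coefficient of `f` as a sum of integrals over the contributions of the cusps. -/
theorem hasSum_integral_cusps {Γ : Subgroup SL(2, ℤ)} [Γ.FiniteIndex] {k : ℝ} (hk : k < 0)
    {f : ℍ → ℂ} (hf : IsHolomorphicModularFunction Γ k f) (hf0 : f ≠ 0) {h : ℕ} (hh : 0 < h)
    {γ : ℚ → SL(2, ℤ)} (hγ : ∀ x, MapsInftyTo (γ x) x) {lam : ℝ} (hlam : lam ∈ exponents f h) :
    HasSum (fun x : {x : ℚ // 0 ≤ x ∧ x < h} =>
      ∫ t : ℝ, (twist f lam ∣[(2 : ℤ)] γ x) (ofComplex (t + (√3 / 2 : ℝ) * I)))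
      (-(h * coeff f h lam)) := by
  have hhR : (0 : ℝ) < h := by exact_mod_cast hh
  have hY : 0 < √3 / 2 := by positivity
  obtain ⟨C, hC⟩ := exists_norm_slash_twist_le hk hf lam
  have hsum := hasSum_integral_slash (mdifferentiable_twist hf.holo lam)
    (slash_translations (twist_vadd hlam)) (bijective_cosetRep hh hγ)
    ((summable_cosetRep hγ (by linarith : 2 < 2 - k)).mul_left C) fun i z hz => hC _ z hz
  have hsum_inr := (hsum.summable.comp_injective Sum.inr_injective).hasSum
  -- The total is `0`, so the cusps contribute the negative of the part coming from `T ^ j`.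
  have htotal := ((hasSum_fintype _).sum hsum_inr).unique hsum
  have hexp : IsExpansion f h (coeff f h) :=
    isExpansion_coeff hf.holo hf0 hhR (norm_exp_two_pi_mul_I_mul lam h) hlam
  have hinl := sum_integral_slash_T_zpow hf.holo hf0 hh hexp hlam hY
  have hval := eq_neg_of_add_eq_zero_right htotal
  simp only [Function.comp_apply, cosetRep] at hval
  rw [← hinl, ← hval]
  -- For fixed `x`, the segments translated by `m` tile the line, so the sum over `m` is the
  -- integral over `ℝ`.
  refine hsum_inr.prod_fiberwise fun x => ?_
  have h1 := (integral_slash_twist hk hf hf0 lam (hγ x).num_den.2 x.1.den_pos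
    hY).1.hasSum_intervalIntegral (-(1 / 2))
  convert! h1 using 2 with m
  simp only [Function.comp_apply, cosetRep, slash_mul_T_zpow _ _ _ hY]
  rw [intervalIntegral.integral_comp_add_right (fun t : ℝ =>
    (twist f lam ∣[(2 : ℤ)] γ x) (ofComplex (t + (√3 / 2 : ℝ) * I))) (m : ℝ)]
  congr 1
  ring

end ModularExpansion

/-! ### The coefficient formula -/

theorem theorem5 (Γ : Subgroup SL(2, ℤ)) [Γ.FiniteIndex] (k : ℝ) (hk : k < 0) (f : ℍ → ℂ)
    (hf : ModularExpansion.IsHolomorphicModularFunction Γ k f) (hf0 : f ≠ 0)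
    (h : ℕ) (hh : IsLeast {n : ℕ | 0 < n ∧ ModularGroup.T ^ n ∈ Γ} h)
    (γ : ℚ → SL(2, ℤ))
    (hγ : ∀ x : ℚ, 0 < γ x 1 0 ∧ x = ((γ x 0 0 : ℤ) : ℚ) / ((γ x 1 0 : ℤ) : ℚ))
    (lam : ℝ) (hlam : lam ∈ ModularExpansion.exponents f h) :
    let term : {x : ℚ // 0 ≤ x ∧ x < h} → ℂ := fun x =>
      (((x.1.den : ℝ) ^ (k - 2) : ℝ) : ℂ) *
        ∑ᶠ mu ∈ {mu : ℝ | mu ∈ ModularExpansion.cuspExponents k f (γ x) ∧ mu < 0},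
          ModularExpansion.beta k f (γ x) lam mu * ((|mu| ^ (1 - k) : ℝ) : ℂ) *
            ModularExpansion.besselL (1 - k) (4 * π ^ 2 * lam * |mu| / (x.1.den : ℂ) ^ 2)
    Summable term ∧
      ModularExpansion.coeff f h lam =
        (((2 * π) ^ (2 - k) / h : ℝ) : ℂ) * ∑' x, term x := by
  intro term
  have hsum := ModularExpansion.hasSum_integral_cusps hk hf hf0 hh.1.1 hγ hlam
  have hterm : HasSum (fun x => -(((2 * π) ^ (2 - k) : ℝ) : ℂ) * term x)
      (-(h * ModularExpansion.coeff f h lam)) := by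
    refine hsum.congr_fun fun x => ?_
    exact (ModularExpansion.integral_slash_twist hk hf hf0 lam
      (ModularExpansion.MapsInftyTo.num_den (hγ x)).2 x.1.den_pos (by positivity)).2.symm
  have hpi : (((2 * π) ^ (2 - k) : ℝ) : ℂ) ≠ 0 := Complex.ofReal_ne_zero.2 (by positivity)
  -- In `ℂ`, `Summable` is the same as absolute convergence.
  refine ⟨(summable_mul_left_iff (neg_ne_zero.2 hpi)).1 hterm.summable, ?_⟩
  have hval := hterm.tsum_eq
  rw [tsum_mul_left] at hval
  have hh0 : (h : ℂ) ≠ 0 := Nat.cast_ne_zero.2 hh.1.1.ne'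
  rw [Complex.ofReal_div, Complex.ofReal_natCast, div_mul_eq_mul_div, eq_div_iff hh0]
  linear_combination hval
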